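/- Let $r\ge 0$ be an integer, let $M$ be a non-empty open subset of $\mathbb{R}^r$ with coordinates $w^0,\dots,w^{r-1}$, and let $a_0,\dots,a_r\in\mathbb{R}$. Let $\mathcal{A}=C^\infty(M)[w^{i,s}:0\le i<r,\ s\ge 1][[\epsilon]]$ be the ring of formal power series in $\epsilon$ whose coefficients are differential polynomials (it contains the completion of the graded ring $C^\infty(M)[\epsilon w^{i,1},\epsilon^2w^{i,2},\dots]$), and write $w^{i,0}=w^i$. Adjoin anticommuting variables $\theta_i^s$ ($0\le i<r$, $s\ge0$): let $V=\bigoplus_{i,s}\mathbb{R}\,\theta_i^s$ and $\hat{\mathcal{A}}=\big(C^\infty(M)[w^{i,s}:s\ge1]\otimes_{\mathbb{R}}\wedge(V)\big)[[\epsilon]]$, graded by the degree in $\theta$, with $$\partial_x=\sum_{i=0}^{r-1}\sum_{s\ge0}\Big(w^{i,s+1}\frac{\partial}{\partial w^{i,s}}+\theta_i^{s+1}\frac{\partial}{\partial\theta_i^s}\Big),$$ where $\partial/\partial\theta_i^s$ are the left derivatives. Write $\theta_i=\theta_i^0$, let $\hat\Lambda=\hat{\mathcal{A}}/\partial_x\hat{\mathcal{A}}$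 with projection $f\mapsto\int f\,dx$, and let $\hat\Lambda^p$ be its part of degree $p$ in $\theta$. For $P\in\hat\Lambda^p$, $Q\in\hat\Lambda^q$ the Schouten–Nijenhuis bracket is $$[P,Q]=\int\sum_{i=0}^{r-1}\Big(\frac{\delta P}{\delta\theta_i}\frac{\delta Q}{\delta w^i}+(-1)^p\frac{\delta P}{\delta w^i}\frac{\delta Q}{\delta\theta_i}\Big)dx,\qquad \frac{\delta}{\delta w^i}=\sum_{s\ge0}(-\partial_x)^s\frac{\partial}{\partial w^{i,s}},\quad \frac{\delta}{\delta\theta_i}=\sum_{s\ge0}(-\partial_x)^s\frac{\partial}{\partial\theta_i^s}.$$ A skew-adjoint matrix differential operator $J=(J^{ij})_{0\le i,j<r}$ with coefficients in $\mathcal{A}$ is identified with the bivector $\int\big(-\tfrac12\sum_{i,j}\theta_iJ^{ij}(\theta_j)\big)dx\in\hat\Lambda^2$. It is called a Hamiltonian operator if $[J,J]=0$; two linearly independent such bivectors $P,Q$ with $[P,P]=[Q,Q]=0$ are called compatible if $[P,Q]=0$. Put $w^r=1$ and $w^l=a_l=0$ for integers $l<0$ or $l>r$, and $$\mathcal{D}_l=2w^l\partial_x+w^l_x-\frac{\epsilon^2}{2}a_l\partial_x^3\quad(l\in\mathbb{Z}).$$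 For $m=0,1,\dots,r$ let $P_m$ be the matrix differential operator with components $$(P_m)^{ij}=f_m^{ij}\,\mathcal{D}_{i+j+1-m},\quad 0\le i,j<r,\qquad f_m^{ij}=\begin{cases}1,& i<m \text{ and } j<m,\\ -1,& i\ge m\text{ and } j\ge m,\\ 0,&\text{otherwise.}\end{cases}$$ **Theorem.** For all $n,m\in\{0,1,\dots,r\}$ one has $[P_n,P_m]=0$. Hence every $P_m$ is a Hamiltonian operator (in particular $P_m$ is skew-adjoint), and for $n\ne m$ the operators $P_n$ and $P_m$ are compatible (in particular linearly independent). -/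

import Mathlib

open scoped ContDiff Manifold TensorProduct
open TopologicalSpace

noncomputable section

namespace KdVCH

/-! ### Smooth functions on the coordinate domain -/

/-- `C^∞(M)`, where the coordinates `w⁰, …, w^{r-1}` identify `M` with an open set of `ℝ^r`. -/
abbrev Smooth (r : ℕ) (M : Opens (Fin r → ℝ)) : Type :=
  ContMDiffMap 𝓘(ℝ, Fin r → ℝ) 𝓘(ℝ, ℝ) M ℝ ∞

/-- Extension by zero of a function on `M`. -/
def ext0 {r : ℕ} {M : Opens (Fin r → ℝ)} (f : M → ℝ) : (Fin r → ℝ) → ℝ :=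
  Function.extend Subtype.val f 0

theorem ext0_apply {r : ℕ} {M : Opens (Fin r → ℝ)} (f : M → ℝ) (x : M) :
    ext0 f (x : Fin r → ℝ) = f x :=
  Subtype.val_injective.extend_apply f 0 x

theorem contDiffAt_ext0 {r : ℕ} {M : Opens (Fin r → ℝ)} (f : Smooth r M) (x : M) :
    ContDiffAt ℝ ∞ (ext0 f) (x : Fin r → ℝ) := by
  rw [← contMDiffAt_iff_contDiffAt, ← contMDiffAt_subtype_iff]
  have h : (fun y : M => ext0 f (y : Fin r → ℝ)) = f := by
    funext y; exact ext0_apply _ y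
  rw [h]
  exact f.contMDiff x

theorem ext0_eventuallyEq {r : ℕ} {M : Opens (Fin r → ℝ)} (f : M → ℝ) (g : (Fin r → ℝ) → ℝ)
    (h : ∀ y : M, f y = g y) (x : M) : ext0 f =ᶠ[nhds (x : Fin r → ℝ)] g := by
  filter_upwards [M.isOpen.mem_nhds x.2] with y hy
  have := ext0_apply f ⟨y, hy⟩
  rw [h ⟨y, hy⟩] at this
  exact this

/-- The partial derivative `∂f/∂w^i` of a smooth function `f` on `M`. -/
def partialFun {r : ℕ} {M : Opens (Fin r → ℝ)} (i : Fin r) (f : Smooth r M) : Smooth r M :=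
  ⟨fun x => fderiv ℝ (ext0 f) (x : Fin r → ℝ) (Pi.single i 1), by
    intro x
    refine (contMDiffAt_subtype_iff
      (f := fun y : Fin r → ℝ => fderiv ℝ (ext0 f) y (Pi.single i 1))).mpr ?_
    rw [contMDiffAt_iff_contDiffAt]
    exact ((contDiffAt_ext0 f x).fderiv_right (m := ∞) (by simp)).clm_apply contDiffAt_const⟩

theorem partialFun_apply {r : ℕ} {M : Opens (Fin r → ℝ)} (i : Fin r) (f : Smooth r M) (x : M) :
    partialFun i f x = fderiv ℝ (ext0 f) (x : Fin r → ℝ) (Pi.single i 1) := rfl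

/-- `∂/∂w^i` as a derivation of `C^∞(M)`. -/
def partialSmooth (r : ℕ) (M : Opens (Fin r → ℝ)) (i : Fin r) :
    Derivation ℝ (Smooth r M) (Smooth r M) :=
  Derivation.mk'
    { toFun := partialFun i
      map_add' := by
        intro f g
        ext x
        have h := ext0_eventuallyEq (⇑(f + g)) (ext0 f + ext0 g)
          (fun y => by simp [ext0_apply]) x
        have hf := (contDiffAt_ext0 f x).differentiableAt (by simp)
        have hg := (contDiffAt_ext0 g x).differentiableAt (by simp)
        simp only [ContMDiffMap.coe_add, Pi.add_apply, partialFun_apply]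
        rw [← ContMDiffMap.coe_add, h.fderiv_eq, fderiv_add hf hg]
        rfl
      map_smul' := by
        intro c f
        ext x
        have h := ext0_eventuallyEq (⇑(c • f)) (c • ext0 f)
          (fun y => by simp [ext0_apply]) x
        have hf := (contDiffAt_ext0 f x).differentiableAt (by simp)
        simp only [ContMDiffMap.coe_smul, Pi.smul_apply, partialFun_apply, RingHom.id_apply]
        rw [← ContMDiffMap.coe_smul, h.fderiv_eq, fderiv_const_smul hf]
        rfl }
    (by
      intro f g
      ext x
      have h := ext0_eventuallyEq (⇑(f * g)) (ext0 f * ext0 g)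
        (fun y => by simp [ext0_apply]) x
      have hf := (contDiffAt_ext0 f x).differentiableAt (by simp)
      have hg := (contDiffAt_ext0 g x).differentiableAt (by simp)
      simp only [LinearMap.coe_mk, AddHom.coe_mk, smul_eq_mul, ContMDiffMap.coe_add,
        ContMDiffMap.coe_mul, Pi.add_apply, Pi.mul_apply, partialFun_apply]
      rw [← ContMDiffMap.coe_mul, h.fderiv_eq, fderiv_mul hf hg]
      simp [ext0_apply])

theorem partialSmooth_apply {r : ℕ} {M : Opens (Fin r → ℝ)} (i : Fin r) (f : Smooth r M)
    (x : M) : partialSmooth r M i f x = fderiv ℝ (ext0 f) (x : Fin r → ℝ) (Pi.single i 1) := rfl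

theorem partialSmooth_comm {r : ℕ} {M : Opens (Fin r → ℝ)} (i j : Fin r) (f : Smooth r M) :
    partialSmooth r M i (partialSmooth r M j f) = partialSmooth r M j (partialSmooth r M i f) := by
  ext x
  have key : ∀ i j : Fin r, partialSmooth r M i (partialSmooth r M j f) x =
      fderiv ℝ (fderiv ℝ (ext0 f)) (x : Fin r → ℝ) (Pi.single i 1) (Pi.single j 1) := by
    intro i j
    have h := ext0_eventuallyEq (⇑(partialSmooth r M j f))
      (fun y => fderiv ℝ (ext0 f) y (Pi.single j 1)) (fun y => rfl) x
    have hd : DifferentiableAt ℝ (fderiv ℝ (ext0 f)) (x : Fin r → ℝ) :=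
      ((contDiffAt_ext0 f x).fderiv_right (m := ∞) (by simp)).differentiableAt (by simp)
    rw [partialSmooth_apply, h.fderiv_eq, fderiv_clm_apply hd (differentiableAt_const _)]
    simp
  rw [key, key]
  exact (contDiffAt_ext0 f x).isSymmSndFDerivAt (by
    rw [minSmoothness_of_isRCLikeNormedField]
    exact WithTop.coe_le_coe.2 (le_top : (2 : ℕ∞) ≤ ⊤)) _ _

/-- The coordinate function `w^i` on `M`. -/
def coord (r : ℕ) (M : Opens (Fin r → ℝ)) (i : Fin r) : Smooth r M :=
  ⟨fun x => (x : Fin r → ℝ) i, by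
    intro x
    refine (contMDiffAt_subtype_iff (f := fun y : Fin r → ℝ => y i)).mpr ?_
    rw [contMDiffAt_iff_contDiffAt]
    exact contDiffAt_apply ℝ ℝ i _⟩

/-! ### Differential polynomials -/

/-- Differential polynomials `C^∞(M)[w^{i,s} : s ≥ 1]`.  The variable indexed by `(i, s)`
is the jet coordinate `w^{i,s+1}`. -/
abbrev DiffPoly (r : ℕ) (M : Opens (Fin r → ℝ)) : Type :=
  MvPolynomial (Fin r × ℕ) (Smooth r M)

/-- A derivation of the coefficients, applied to a polynomial coefficient by coefficient. -/
def coeffLin (σ : Type) {A : Type} [CommRing A] [Algebra ℝ A] (d : Derivation ℝ A A) :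
    MvPolynomial σ A →ₗ[ℝ] MvPolynomial σ A where
  toFun p := AddMonoidAlgebra.map (d : A →ₗ[ℝ] A).toAddMonoidHom p
  map_add' p q := AddMonoidAlgebra.map_add _ p q
  map_smul' c p := by
    ext m
    change d (c • MvPolynomial.coeff m p) = c • d (MvPolynomial.coeff m p)
    simp

theorem coeffLin_monomial {σ A : Type} [CommRing A] [Algebra ℝ A] (d : Derivation ℝ A A)
    (m : σ →₀ ℕ) (c : A) :
    coeffLin σ d (MvPolynomial.monomial m c) = MvPolynomial.monomial m (d c) :=
  AddMonoidAlgebra.map_single _ c m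

theorem coeffLin_leibniz {σ A : Type} [CommRing A] [Algebra ℝ A] (d : Derivation ℝ A A)
    (p q : MvPolynomial σ A) :
    coeffLin σ d (p * q) = p • coeffLin σ d q + q • coeffLin σ d p := by
  induction p using MvPolynomial.induction_on' with
  | add p₁ p₂ h₁ h₂ => simp only [add_mul, map_add, h₁, h₂, smul_eq_mul]; ring
  | monomial m a =>
    induction q using MvPolynomial.induction_on' with
    | add q₁ q₂ h₁ h₂ => simp only [mul_add, map_add, h₁, h₂, smul_eq_mul]; ring
    | monomial n b =>
      simp only [MvPolynomial.monomial_mul, coeffLin_monomial, smul_eq_mul, Derivation.leibniz,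
        map_add]
      rw [add_comm n m]

/-- A derivation `d` of `A` extended to `A[σ]` by annihilating the variables. -/
def coeffDer (σ : Type) {A : Type} [CommRing A] [Algebra ℝ A] (d : Derivation ℝ A A) :
    Derivation ℝ (MvPolynomial σ A) (MvPolynomial σ A) :=
  Derivation.mk' (coeffLin σ d) (coeffLin_leibniz d)

theorem coeffDer_C {σ A : Type} [CommRing A] [Algebra ℝ A] (d : Derivation ℝ A A) (c : A) :
    coeffDer σ d (MvPolynomial.C c) = MvPolynomial.C (d c) := coeffLin_monomial d 0 c

theorem coeffDer_X {σ A : Type} [CommRing A] [Algebra ℝ A] (d : Derivation ℝ A A) (j : σ) :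
    coeffDer σ d (MvPolynomial.X j) = 0 := by
  have h : coeffLin σ d (MvPolynomial.monomial (Finsupp.single j 1) 1) = 0 := by
    rw [coeffLin_monomial]; simp
  exact h

/-- `∂/∂w^{i,s}` on differential polynomials. -/
def dw (r : ℕ) (M : Opens (Fin r → ℝ)) (i : Fin r) :
    ℕ → Derivation ℝ (DiffPoly r M) (DiffPoly r M)
  | 0 => coeffDer _ (partialSmooth r M i)
  | s + 1 => (MvPolynomial.pderiv (i, s)).restrictScalars ℝ

/-- The total derivative
`∂_x = ∑ᵢ w^{i,1} ∂/∂w^{i,0} + ∑ᵢ ∑_{s ≥ 1} w^{i,s+1} ∂/∂w^{i,s}` on differential polynomials;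
the second sum is the `C^∞(M)`-linear derivation with `w^{i,s} ↦ w^{i,s+1}` for `s ≥ 1`. -/
def totalD (r : ℕ) (M : Opens (Fin r → ℝ)) : Derivation ℝ (DiffPoly r M) (DiffPoly r M) :=
  (∑ i : Fin r, (MvPolynomial.X (i, 0) : DiffPoly r M) • dw r M i 0) +
    (MvPolynomial.mkDerivation (Smooth r M)
      (fun p : Fin r × ℕ => (MvPolynomial.X (p.1, p.2 + 1) : DiffPoly r M))).restrictScalars ℝ

theorem totalD_apply {r : ℕ} {M : Opens (Fin r → ℝ)} (f : DiffPoly r M) :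
    totalD r M f = (∑ i : Fin r, MvPolynomial.X (i, 0) * dw r M i 0 f) +
      MvPolynomial.mkDerivation (Smooth r M)
        (fun p : Fin r × ℕ => (MvPolynomial.X (p.1, p.2 + 1) : DiffPoly r M)) f := by
  rw [totalD, Derivation.add_apply]
  congr 1
  rw [← Derivation.coeFnAddMonoidHom_apply, map_sum, Finset.sum_apply]
  rfl

theorem totalD_C {r : ℕ} {M : Opens (Fin r → ℝ)} (c : Smooth r M) :
    totalD r M (MvPolynomial.C c) =
      ∑ i : Fin r, MvPolynomial.X (i, 0) * MvPolynomial.C (partialSmooth r M i c) := by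
  simp [totalD_apply, dw, coeffDer_C]

theorem totalD_X {r : ℕ} {M : Opens (Fin r → ℝ)} (p : Fin r × ℕ) :
    totalD r M (MvPolynomial.X p) = MvPolynomial.X (p.1, p.2 + 1) := by
  simp [totalD_apply, dw, coeffDer_X]

/-- Two derivations of `A[σ]` agreeing on constants and variables are equal. -/
theorem der_ext {σ A : Type} [CommRing A] [Algebra ℝ A]
    {d e : Derivation ℝ (MvPolynomial σ A) (MvPolynomial σ A)}
    (hC : ∀ c, d (MvPolynomial.C c) = e (MvPolynomial.C c))
    (hX : ∀ j, d (MvPolynomial.X j) = e (MvPolynomial.X j)) : d = e := by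
  ext1 p
  induction p using MvPolynomial.induction_on with
  | C c => exact hC c
  | add p q hp hq => simp [hp, hq]
  | mul_X p j hp => simp [hp, hX]

theorem dw_zero_totalD {r : ℕ} {M : Opens (Fin r → ℝ)} (i : Fin r) (f : DiffPoly r M) :
    dw r M i 0 (totalD r M f) = totalD r M (dw r M i 0 f) := by
  have : ⁅dw r M i 0, totalD r M⁆ = 0 := by
    apply der_ext
    · intro c
      simp [Derivation.commutator_apply, totalD_C, dw, coeffDer_C, coeffDer_X,
        partialSmooth_comm i]
    · intro p
      simp [Derivation.commutator_apply, totalD_X, dw, coeffDer_X]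
  have h := congrArg (fun d => d f) this
  simpa [Derivation.commutator_apply, sub_eq_zero] using h

theorem dw_succ_totalD {r : ℕ} {M : Opens (Fin r → ℝ)} (i : Fin r) (s : ℕ) (f : DiffPoly r M) :
    dw r M i (s + 1) (totalD r M f) = totalD r M (dw r M i (s + 1) f) + dw r M i s f := by
  have : ⁅dw r M i (s + 1), totalD r M⁆ = dw r M i s := by
    apply der_ext
    · intro c
      cases s with
      | zero =>
        simp [Derivation.commutator_apply, totalD_C, dw, coeffDer_C, MvPolynomial.pderiv_X,
          Pi.single_apply, Prod.ext_iff]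
      | succ s =>
        simp [Derivation.commutator_apply, totalD_C, dw, MvPolynomial.pderiv_X,
          Prod.ext_iff]
    · intro p
      cases s with
      | zero =>
        simp [Derivation.commutator_apply, totalD_X, dw, coeffDer_X, MvPolynomial.pderiv_X,
          Pi.single_apply, Prod.ext_iff, apply_ite (totalD r M)]
      | succ s =>
        simp [Derivation.commutator_apply, totalD_X, dw, MvPolynomial.pderiv_X,
          Pi.single_apply, Prod.ext_iff, apply_ite (totalD r M)]
  have h := congrArg (fun d => d f) this
  simp only [Derivation.commutator_apply] at h
  rw [← h]; abel

theorem dw_finite {r : ℕ} {M : Opens (Fin r → ℝ)} (i : Fin r) (f : DiffPoly r M) :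
    (Function.support fun s => dw r M i s f).Finite := by
  classical
  refine ((f.vars.image fun p => p.2 + 1) ∪ {0}).finite_toSet.subset ?_
  intro s hs
  cases s with
  | zero => simp
  | succ s =>
    have : (i, s) ∈ f.vars := by
      by_contra h
      exact hs (MvPolynomial.pderiv_eq_zero_of_notMem_vars h)
    simp only [Finset.coe_union, Finset.coe_image, Set.mem_union, Set.mem_image]
    exact Or.inl ⟨_, this, rfl⟩

/-! ### Super variables -/

/-- `V = ⨁_{i,s} ℝ θ_i^s`. -/
abbrev ThetaSpace (r : ℕ) : Type := (Fin r × ℕ) →₀ ℝ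

/-- The exterior algebra `∧(V)`. -/
abbrev ThetaAlg (r : ℕ) : Type := ExteriorAlgebra ℝ (ThetaSpace r)

/-- The generator `θ_i^s` of `∧(V)`. -/
def th (r : ℕ) (i : Fin r) (s : ℕ) : ThetaAlg r := ExteriorAlgebra.ι ℝ (Finsupp.single (i, s) 1)

/-- `∂/∂θ_i^s` on `∧(V)`: contraction from the left with the coordinate functional of `θ_i^s`. -/
def dth (r : ℕ) (i : Fin r) (s : ℕ) : ThetaAlg r →ₗ[ℝ] ThetaAlg r :=
  CliffordAlgebra.contractLeft (Finsupp.lapply (i, s))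

/-- The linear map `V → V` with `θ_i^s ↦ θ_i^{s+1}`. -/
def shift (r : ℕ) : ThetaSpace r →ₗ[ℝ] ThetaSpace r :=
  Finsupp.lmapDomain ℝ ℝ fun p => (p.1, p.2 + 1)

/-- The algebra map `1 + η T : ∧(V) → ∧(V)[η]`, `η² = 0`, for the derivation `T` below. -/
def shiftLift (r : ℕ) : ThetaAlg r →ₐ[ℝ] TrivSqZeroExt (ThetaAlg r) (ThetaAlg r) :=
  ExteriorAlgebra.lift ℝ
    ⟨{ toFun := fun v => TrivSqZeroExt.inl (ExteriorAlgebra.ι ℝ v) +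
          TrivSqZeroExt.inr (ExteriorAlgebra.ι ℝ (shift r v))
       map_add' := fun v w => by ext <;> simp
       map_smul' := fun c v => by ext <;> simp },
      fun v => by
        ext
        · simp
        · have := ExteriorAlgebra.ι_add_mul_swap (R := ℝ) v (shift r v)
          simp [this]⟩

/-- The derivation `∑_{i,s} θ_i^{s+1} ∂/∂θ_i^s` of `∧(V)`, that is, the derivation with
`θ_i^s ↦ θ_i^{s+1}`. -/
def shiftDer (r : ℕ) : ThetaAlg r →ₗ[ℝ] ThetaAlg r :=
  (TrivSqZeroExt.sndHom (ThetaAlg r) (ThetaAlg r)).restrictScalars ℝ ∘ₗ (shiftLift r).toLinearMap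

theorem shiftDer_apply {r : ℕ} (x : ThetaAlg r) : shiftDer r x = (shiftLift r x).snd := rfl

theorem shiftLift_ι {r : ℕ} (v : ThetaSpace r) :
    shiftLift r (ExteriorAlgebra.ι ℝ v) = TrivSqZeroExt.inl (ExteriorAlgebra.ι ℝ v) +
      TrivSqZeroExt.inr (ExteriorAlgebra.ι ℝ (shift r v)) := by
  rw [shiftLift, ExteriorAlgebra.lift_ι_apply]
  rfl

theorem shiftLift_fst {r : ℕ} (x : ThetaAlg r) : (shiftLift r x).fst = x := by
  have h : (TrivSqZeroExt.fstHom ℝ (ThetaAlg r) (ThetaAlg r)).comp (shiftLift r) =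
      AlgHom.id ℝ _ := by
    apply ExteriorAlgebra.hom_ext
    ext v
    simp [shiftLift_ι]
  exact DFunLike.congr_fun h x

theorem shiftDer_ι {r : ℕ} (v : ThetaSpace r) :
    shiftDer r (ExteriorAlgebra.ι ℝ v) = ExteriorAlgebra.ι ℝ (shift r v) := by
  simp [shiftDer_apply, shiftLift_ι]

theorem shiftDer_th {r : ℕ} (i : Fin r) (s : ℕ) : shiftDer r (th r i s) = th r i (s + 1) := by
  rw [th, shiftDer_ι, shift, Finsupp.lmapDomain_apply, Finsupp.mapDomain_single, th]

theorem shiftDer_mul {r : ℕ} (x y : ThetaAlg r) :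
    shiftDer r (x * y) = x * shiftDer r y + shiftDer r x * y := by
  simp [shiftDer_apply, shiftLift_fst]

theorem shiftDer_algebraMap {r : ℕ} (c : ℝ) :
    shiftDer r (algebraMap ℝ (ThetaAlg r) c) = 0 := by
  rw [shiftDer_apply, AlgHom.commutes]
  simp [TrivSqZeroExt.algebraMap_eq_inl']

theorem dth_ι_mul {r : ℕ} (i : Fin r) (s : ℕ) (v : ThetaSpace r) (x : ThetaAlg r) :
    dth r i s (ExteriorAlgebra.ι ℝ v * x) = v (i, s) • x - ExteriorAlgebra.ι ℝ v * dth r i s x :=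
  CliffordAlgebra.contractLeft_ι_mul (Q := (0 : QuadraticForm ℝ (ThetaSpace r)))
    (d := Finsupp.lapply (i, s)) v x

theorem dth_algebraMap {r : ℕ} (i : Fin r) (s : ℕ) (c : ℝ) :
    dth r i s (algebraMap ℝ (ThetaAlg r) c) = 0 :=
  CliffordAlgebra.contractLeft_algebraMap (Q := (0 : QuadraticForm ℝ (ThetaSpace r)))
    (d := Finsupp.lapply (i, s)) c

theorem shift_apply_zero {r : ℕ} (v : ThetaSpace r) (i : Fin r) : shift r v (i, 0) = 0 := by
  rw [shift, Finsupp.lmapDomain_apply, Finsupp.mapDomain_of_notMem_range]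
  rintro ⟨p, hp⟩
  simp at hp

theorem shift_apply_succ {r : ℕ} (v : ThetaSpace r) (i : Fin r) (s : ℕ) :
    shift r v (i, s + 1) = v (i, s) := by
  have hinj : Function.Injective fun p : Fin r × ℕ => (p.1, p.2 + 1) := by
    rintro ⟨a, b⟩ ⟨c, d⟩ h
    simpa using h
  exact Finsupp.mapDomain_apply hinj v (i, s)

theorem dth_zero_shiftDer {r : ℕ} (i : Fin r) (x : ThetaAlg r) :
    dth r i 0 (shiftDer r x) = shiftDer r (dth r i 0 x) := by
  induction x using CliffordAlgebra.left_induction with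
  | algebraMap c =>
    have h1 := shiftDer_algebraMap (r := r) c
    have h2 := dth_algebraMap (r := r) i 0 c
    exact (congrArg _ h1).trans ((map_zero _).trans ((congrArg _ h2).trans (map_zero _)).symm)
  | add x y hx hy => simp only [map_add, hx, hy]
  | ι_mul x v hx =>
    change dth r i 0 (shiftDer r (ExteriorAlgebra.ι ℝ v * x)) =
      shiftDer r (dth r i 0 (ExteriorAlgebra.ι ℝ v * x))
    simp only [shiftDer_mul, dth_ι_mul, shiftDer_ι, map_add, map_sub, map_smul, hx,
      shift_apply_zero, zero_smul]
    abel

theorem dth_succ_shiftDer {r : ℕ} (i : Fin r) (s : ℕ) (x : ThetaAlg r) :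
    dth r i (s + 1) (shiftDer r x) = shiftDer r (dth r i (s + 1) x) + dth r i s x := by
  induction x using CliffordAlgebra.left_induction with
  | algebraMap c =>
    change dth r i (s + 1) (shiftDer r (algebraMap ℝ (ThetaAlg r) c)) =
      shiftDer r (dth r i (s + 1) (algebraMap ℝ (ThetaAlg r) c)) +
        dth r i s (algebraMap ℝ (ThetaAlg r) c)
    simp only [shiftDer_algebraMap, dth_algebraMap, map_zero, add_zero]
  | add x y hx hy => simp only [map_add, hx, hy]; abel
  | ι_mul x v hx =>
    change dth r i (s + 1) (shiftDer r (ExteriorAlgebra.ι ℝ v * x)) =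
      shiftDer r (dth r i (s + 1) (ExteriorAlgebra.ι ℝ v * x)) +
        dth r i s (ExteriorAlgebra.ι ℝ v * x)
    simp only [shiftDer_mul, dth_ι_mul, shiftDer_ι, map_add, map_sub, map_smul, hx,
      shift_apply_succ, mul_add]
    abel

theorem dth_finite {r : ℕ} (i : Fin r) (x : ThetaAlg r) :
    (Function.support fun s => dth r i s x).Finite := by
  induction x using CliffordAlgebra.left_induction with
  | algebraMap c =>
    refine Set.finite_empty.subset fun s hs => hs ?_
    exact dth_algebraMap i s c
  | add x y hx hy =>
    refine (hx.union hy).subset ?_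
    simp only [map_add]
    exact Function.support_add _ _
  | ι_mul x v hx =>
    refine (hx.union (v.support.image Prod.snd).finite_toSet).subset ?_
    intro s hs
    by_contra h
    simp only [Set.mem_union, not_or, Function.mem_support, not_not] at h
    apply hs
    have hv : v (i, s) = 0 := by
      by_contra h0
      exact h.2 (Finset.mem_coe.2 (Finset.mem_image.2 ⟨(i, s), Finsupp.mem_support_iff.2 h0, rfl⟩))
    refine (dth_ι_mul i s v x).trans ?_
    rw [hv, h.1]
    simp

/-! ### Variational derivatives: algebra -/

/-- For a locally finite family `E s` of operators, the operator `∑_s (-D)^s ∘ E s`. -/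
def eulerSum {N : Type} [AddCommGroup N] [Module ℝ N] (D : N →ₗ[ℝ] N) (E : ℕ → N →ₗ[ℝ] N)
    (hE : ∀ x, (Function.support fun s => E s x).Finite) : N →ₗ[ℝ] N where
  toFun x := ∑ᶠ s : ℕ, ((-D) ^ s) (E s x)
  map_add' x y := by
    have h : ∀ x, (Function.support fun s => ((-D) ^ s) (E s x)).Finite := fun x =>
      (hE x).subset fun s hs h0 => hs (by simp only [h0, map_zero])
    simp only [map_add]
    exact finsum_add_distrib (h x) (h y)
  map_smul' c x := by
    have h : (Function.support fun s => ((-D) ^ s) (E s x)).Finite :=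
      (hE x).subset fun s hs h0 => hs (by simp only [h0, map_zero])
    simp only [map_smul, RingHom.id_apply]
    exact (smul_finsum' c h).symm

theorem eulerSum_comp {N : Type} [AddCommGroup N] [Module ℝ N] (D : N →ₗ[ℝ] N)
    (E : ℕ → N →ₗ[ℝ] N) (hE : ∀ x, (Function.support fun s => E s x).Finite)
    (h0 : ∀ x, E 0 (D x) = D (E 0 x)) (h1 : ∀ s x, E (s + 1) (D x) = D (E (s + 1) x) + E s x)
    (x : N) : eulerSum D E hE (D x) = 0 := by
  obtain ⟨n, hn⟩ := (hE x).bddAbove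
  have hz : ∀ s, n < s → E s x = 0 := fun s hs => by
    by_contra h
    exact absurd (hn h) (not_le.2 hs)
  have hpart : ∀ k, ∑ s ∈ Finset.range (k + 1), ((-D) ^ s) (E s (D x)) =
      -((-D) ^ (k + 1)) (E k x) := by
    intro k
    induction k with
    | zero => simp [h0]
    | succ k ih =>
      rw [Finset.sum_range_succ, ih, h1, map_add, pow_succ (-D) (k + 1), Module.End.mul_apply]
      simp
  change ∑ᶠ s : ℕ, ((-D) ^ s) (E s (D x)) = 0
  rw [finsum_eq_sum_of_support_subset (s := Finset.range (n + 1 + 1)), hpart, hz _ (by omega)]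
  · simp
  · intro s hs
    by_contra h
    simp only [Finset.coe_range, Set.mem_Iio, not_lt] at h
    apply hs
    obtain ⟨t, rfl⟩ : ∃ t, s = t + 1 := ⟨s - 1, by omega⟩
    simp only [h1, hz (t + 1) (by omega), hz t (by omega), map_zero, add_zero]

/-! ### Functionals of super variables -/

/-- `C^∞(M)[w^{i,s} : s ≥ 1] ⊗ ∧(V)`. -/
abbrev SuperPoly (r : ℕ) (M : Opens (Fin r → ℝ)) : Type := DiffPoly r M ⊗[ℝ] ThetaAlg r

/-- `∂_x` on differential polynomials in `w` and `θ`. -/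
def superD (r : ℕ) (M : Opens (Fin r → ℝ)) : SuperPoly r M →ₗ[ℝ] SuperPoly r M :=
  LinearMap.rTensor (ThetaAlg r) (totalD r M : DiffPoly r M →ₗ[ℝ] DiffPoly r M) +
    LinearMap.lTensor (DiffPoly r M) (shiftDer r)

/-- `∂/∂w^{i,s}` on differential polynomials in `w` and `θ`. -/
def superDw (r : ℕ) (M : Opens (Fin r → ℝ)) (i : Fin r) (s : ℕ) :
    SuperPoly r M →ₗ[ℝ] SuperPoly r M :=
  LinearMap.rTensor (ThetaAlg r) (dw r M i s : DiffPoly r M →ₗ[ℝ] DiffPoly r M)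

/-- `∂/∂θ_i^s` on differential polynomials in `w` and `θ`. -/
def superDth (r : ℕ) (M : Opens (Fin r → ℝ)) (i : Fin r) (s : ℕ) :
    SuperPoly r M →ₗ[ℝ] SuperPoly r M :=
  LinearMap.lTensor (DiffPoly r M) (dth r i s)

theorem finite_support_of_tmul {A B N : Type} [AddCommGroup A] [Module ℝ A] [AddCommGroup B]
    [Module ℝ B] [AddCommGroup N] [Module ℝ N] (E : ℕ → A ⊗[ℝ] B →ₗ[ℝ] N)
    (h : ∀ a b, (Function.support fun s => E s (a ⊗ₜ b)).Finite) (x : A ⊗[ℝ] B) :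
    (Function.support fun s => E s x).Finite := by
  induction x using TensorProduct.induction_on with
  | zero => simp
  | tmul a b => exact h a b
  | add x y hx hy =>
    refine (hx.union hy).subset ?_
    simp only [map_add]
    exact Function.support_add _ _

theorem superDw_finite {r : ℕ} {M : Opens (Fin r → ℝ)} (i : Fin r) (x : SuperPoly r M) :
    (Function.support fun s => superDw r M i s x).Finite :=
  finite_support_of_tmul _ (fun a b => (dw_finite i a).subset fun s hs h0 => hs (by
    simp only [superDw, LinearMap.rTensor_tmul, Derivation.coeFn_coe]
    exact (congrArg (· ⊗ₜ[ℝ] b) h0).trans (TensorProduct.zero_tmul _ _))) x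

theorem superDth_finite {r : ℕ} {M : Opens (Fin r → ℝ)} (i : Fin r) (x : SuperPoly r M) :
    (Function.support fun s => superDth r M i s x).Finite :=
  finite_support_of_tmul _ (fun a b => (dth_finite i b).subset fun s hs h0 => hs (by
    simp only [superDth, LinearMap.lTensor_tmul]
    exact (congrArg (a ⊗ₜ[ℝ] ·) h0).trans (TensorProduct.tmul_zero _ _))) x

/-- `δ/δw^i = ∑_s (-∂_x)^s ∂/∂w^{i,s}`. -/
def superVarW (r : ℕ) (M : Opens (Fin r → ℝ)) (i : Fin r) : SuperPoly r M →ₗ[ℝ] SuperPoly r M :=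
  eulerSum (superD r M) (superDw r M i) (superDw_finite i)

/-- `δ/δθ_i = ∑_s (-∂_x)^s ∂/∂θ_i^s`. -/
def superVarTh (r : ℕ) (M : Opens (Fin r → ℝ)) (i : Fin r) : SuperPoly r M →ₗ[ℝ] SuperPoly r M :=
  eulerSum (superD r M) (superDth r M i) (superDth_finite i)

theorem superVarW_superD {r : ℕ} {M : Opens (Fin r → ℝ)} (i : Fin r) (x : SuperPoly r M) :
    superVarW r M i (superD r M x) = 0 := by
  apply eulerSum_comp
  · intro x
    induction x using TensorProduct.induction_on with
    | zero => simp
    | tmul a b => simp [superDw, superD, dw_zero_totalD]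
    | add x y hx hy => simp only [map_add, hx, hy]
  · intro s x
    induction x using TensorProduct.induction_on with
    | zero => simp
    | tmul a b =>
      simp only [superDw, superD, LinearMap.add_apply, LinearMap.rTensor_tmul,
        LinearMap.lTensor_tmul, Derivation.coeFn_coe, map_add, dw_succ_totalD,
        TensorProduct.add_tmul]
      abel
    | add x y hx hy => simp only [map_add, hx, hy]; abel

theorem superVarTh_superD {r : ℕ} {M : Opens (Fin r → ℝ)} (i : Fin r) (x : SuperPoly r M) :
    superVarTh r M i (superD r M x) = 0 := by
  apply eulerSum_comp
  · intro x
    induction x using TensorProduct.induction_on with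
    | zero => simp
    | tmul a b => simp [superDth, superD, dth_zero_shiftDer]
    | add x y hx hy => simp only [map_add, hx, hy]
  · intro s x
    induction x using TensorProduct.induction_on with
    | zero => simp
    | tmul a b =>
      simp only [superDth, superD, LinearMap.add_apply, LinearMap.rTensor_tmul,
        LinearMap.lTensor_tmul, Derivation.coeFn_coe, map_add, dth_succ_shiftDer,
        TensorProduct.tmul_add]
      abel
    | add x y hx hy => simp only [map_add, hx, hy]; abel

/-! ### The formal parameter `ε` -/

/-- Apply a linear map to the coefficients of a formal power series in `ε`. -/
def epsMap {A B : Type} [Semiring A] [Semiring B] [Algebra ℝ A] [Algebra ℝ B] (L : A →ₗ[ℝ] B) :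
    PowerSeries A →ₗ[ℝ] PowerSeries B where
  toFun f := PowerSeries.mk fun n => L (PowerSeries.coeff n f)
  map_add' f g := by ext n; simp
  map_smul' c f := by
    ext n
    change PowerSeries.coeff n (PowerSeries.mk fun n => L (c • PowerSeries.coeff n f)) =
      c • PowerSeries.coeff n (PowerSeries.mk fun n => L (PowerSeries.coeff n f))
    simp only [PowerSeries.coeff_mk, map_smul]

/-- `𝒜`: formal power series in `ε` with coefficients in the differential polynomials.  The series
`∑ ε^k f_k` with `f_k` homogeneous of degree `k` (`deg w^{i,s} = s`) form the completion of
`C^∞(M)[ε w^i_x, ε² w^i_xx, …]` with respect to its gradation; the larger ring is closed under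
`∂_x`. -/
abbrev DiffAlg (r : ℕ) (M : Opens (Fin r → ℝ)) : Type := PowerSeries (DiffPoly r M)

/-- `∂_x` on `𝒜`. -/
def dx (r : ℕ) (M : Opens (Fin r → ℝ)) : DiffAlg r M →ₗ[ℝ] DiffAlg r M :=
  epsMap (totalD r M : DiffPoly r M →ₗ[ℝ] DiffPoly r M)

/-- `𝒜̂ = 𝒜 ⊗ ∧(V)`, completed in `ε`. -/
abbrev SuperAlg (r : ℕ) (M : Opens (Fin r → ℝ)) : Type := PowerSeries (SuperPoly r M)

/-- `∂_x` on `𝒜̂`. -/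
def sdx (r : ℕ) (M : Opens (Fin r → ℝ)) : SuperAlg r M →ₗ[ℝ] SuperAlg r M :=
  epsMap (superD r M)

/-- The inclusion `𝒜 → 𝒜̂`. -/
def incl (r : ℕ) (M : Opens (Fin r → ℝ)) : DiffAlg r M →+* SuperAlg r M :=
  PowerSeries.map
    (Algebra.TensorProduct.includeLeftRingHom : DiffPoly r M →+* DiffPoly r M ⊗[ℝ] ThetaAlg r)

/-- The generator `θ_i^s` of `𝒜̂`. -/
def theta (r : ℕ) (M : Opens (Fin r → ℝ)) (i : Fin r) (s : ℕ) : SuperAlg r M :=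
  PowerSeries.C (1 ⊗ₜ[ℝ] th r i s)

/-- `Λ̂ = 𝒜̂ / ∂_x 𝒜̂`. -/
abbrev Functional (r : ℕ) (M : Opens (Fin r → ℝ)) : Type :=
  SuperAlg r M ⧸ LinearMap.range (sdx r M)

/-- The projection `𝒜̂ → Λ̂`, `f ↦ ∫ f dx`. -/
def integral (r : ℕ) (M : Opens (Fin r → ℝ)) : SuperAlg r M →ₗ[ℝ] Functional r M :=
  (LinearMap.range (sdx r M)).mkQ

theorem epsMap_comp_eq_zero {A : Type} [Semiring A] [Algebra ℝ A] (L D : A →ₗ[ℝ] A)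
    (h : ∀ x, L (D x) = 0) : LinearMap.range (epsMap D) ≤ LinearMap.ker (epsMap L) := by
  rintro _ ⟨f, rfl⟩
  rw [LinearMap.mem_ker]
  ext n
  simp [epsMap, h]

/-- The variational derivative `δP/δw^i` of `P ∈ Λ̂`. -/
def varW (r : ℕ) (M : Opens (Fin r → ℝ)) (i : Fin r) : Functional r M →ₗ[ℝ] SuperAlg r M :=
  (LinearMap.range (sdx r M)).liftQ (epsMap (superVarW r M i))
    (epsMap_comp_eq_zero _ _ (superVarW_superD i))

/-- The variational derivative `δP/δθ_i` of `P ∈ Λ̂`. -/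
def varTh (r : ℕ) (M : Opens (Fin r → ℝ)) (i : Fin r) : Functional r M →ₗ[ℝ] SuperAlg r M :=
  (LinearMap.range (sdx r M)).liftQ (epsMap (superVarTh r M i))
    (epsMap_comp_eq_zero _ _ (superVarTh_superD i))

/-- Elements of degree `p` in the super variables, at a fixed power of `ε`. -/
def superPolyDeg (r : ℕ) (M : Opens (Fin r → ℝ)) (p : ℕ) : Submodule ℝ (SuperPoly r M) :=
  LinearMap.range (LinearMap.lTensor (DiffPoly r M) (⋀[ℝ]^p (ThetaSpace r)).subtype)

/-- The elements of `𝒜̂` of degree `p` in the super variables. -/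
def superDeg (r : ℕ) (M : Opens (Fin r → ℝ)) (p : ℕ) : Submodule ℝ (SuperAlg r M) where
  carrier := {f | ∀ n, PowerSeries.coeff n f ∈ superPolyDeg r M p}
  add_mem' hf hg n := by
    rw [map_add]
    exact add_mem (hf n) (hg n)
  zero_mem' n := by simp
  smul_mem' c f hf n := (superPolyDeg r M p).smul_mem c (hf n)

/-- `Λ̂^p`, the space of local `p`-vectors. -/
def MultiVec (r : ℕ) (M : Opens (Fin r → ℝ)) (p : ℕ) : Submodule ℝ (Functional r M) :=
  (superDeg r M p).map (integral r M)

/-- The Schouten–Nijenhuis bracket of `P ∈ Λ̂^p` and `Q ∈ Λ̂^q`. -/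
def schouten {r : ℕ} {M : Opens (Fin r → ℝ)} {p q : ℕ} (P : MultiVec r M p)
    (Q : MultiVec r M q) : Functional r M :=
  integral r M (∑ i : Fin r,
    (varTh r M i P * varW r M i Q + (-1 : ℝ) ^ p • (varW r M i P * varTh r M i Q)))

/-- A Poisson bivector: `[P, P] = 0`. -/
def IsPoisson {r : ℕ} {M : Opens (Fin r → ℝ)} (P : MultiVec r M 2) : Prop := schouten P P = 0

/-- Two linearly independent Poisson bivectors are compatible if `[P, Q] = 0`. -/
def Compatible {r : ℕ} {M : Opens (Fin r → ℝ)} (P Q : MultiVec r M 2) : Prop :=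
  IsPoisson P ∧ IsPoisson Q ∧ LinearIndependent ℝ ![P, Q] ∧ schouten P Q = 0

/-! ### Matrix differential operators -/

/-- Differential operators `∑_s P_s ∂_x^s` with coefficients `P_s ∈ 𝒜`. -/
abbrev DiffOp (r : ℕ) (M : Opens (Fin r → ℝ)) : Type := ℕ →₀ DiffAlg r M

/-- `∑_s P_s ∂_x^s φ` for `φ ∈ 𝒜`. -/
def DiffOp.act {r : ℕ} {M : Opens (Fin r → ℝ)} (P : DiffOp r M) (φ : DiffAlg r M) : DiffAlg r M :=
  P.sum fun s c => c * (dx r M ^ s) φ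

/-- The adjoint `∑_s (-∂_x)^s ∘ P_s`, applied to `φ ∈ 𝒜`. -/
def DiffOp.adjAct {r : ℕ} {M : Opens (Fin r → ℝ)} (P : DiffOp r M) (φ : DiffAlg r M) :
    DiffAlg r M :=
  P.sum fun s c => ((-dx r M) ^ s) (c * φ)

/-- `∑_s P_s ∂_x^s φ` for `φ ∈ 𝒜̂`. -/
def DiffOp.superAct {r : ℕ} {M : Opens (Fin r → ℝ)} (P : DiffOp r M) (φ : SuperAlg r M) :
    SuperAlg r M :=
  P.sum fun s c => incl r M c * (sdx r M ^ s) φ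

/-- Matrix differential operators `J = (J^{ij})`, `i, j = 0, …, r - 1`. -/
abbrev MatDiffOp (r : ℕ) (M : Opens (Fin r → ℝ)) : Type := Fin r → Fin r → DiffOp r M

/-- `J + J† = 0`, where `(J†)^{ij} = ∑_s (-∂_x)^s ∘ J^{ji}_s`, as operators on `𝒜`. -/
def MatDiffOp.IsSkewAdjoint {r : ℕ} {M : Opens (Fin r → ℝ)} (J : MatDiffOp r M) : Prop :=
  ∀ (i j : Fin r) (φ : DiffAlg r M), (J i j).act φ + (J j i).adjAct φ = 0

/-- The density `-½ ∑_{i,j} θ_i J^{ij}(θ_j)`. -/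
def MatDiffOp.density {r : ℕ} {M : Opens (Fin r → ℝ)} (J : MatDiffOp r M) : SuperAlg r M :=
  (-(1 / 2) : ℝ) • ∑ i : Fin r, ∑ j : Fin r, theta r M i 0 * (J i j).superAct (theta r M j 0)

theorem sdx_pow_theta {r : ℕ} {M : Opens (Fin r → ℝ)} (j : Fin r) (s : ℕ) :
    (sdx r M ^ s) (theta r M j 0) = theta r M j s := by
  induction s with
  | zero => rfl
  | succ s ih =>
    rw [pow_succ', Module.End.mul_apply, ih]
    ext n
    simp only [sdx, epsMap, theta, LinearMap.coe_mk, AddHom.coe_mk, PowerSeries.coeff_mk,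
      PowerSeries.coeff_C]
    split_ifs
    · simp [superD, shiftDer_th]
    · simp

theorem MatDiffOp.density_mem {r : ℕ} {M : Opens (Fin r → ℝ)} (J : MatDiffOp r M) :
    J.density ∈ superDeg r M 2 := by
  refine Submodule.smul_mem _ _ (Submodule.sum_mem _ fun i _ => Submodule.sum_mem _ fun j _ => ?_)
  rw [DiffOp.superAct, Finsupp.sum, Finset.mul_sum]
  refine Submodule.sum_mem _ fun s _ n => ?_
  rw [sdx_pow_theta, theta, theta, PowerSeries.coeff_C_mul, PowerSeries.coeff_mul_C, incl,
    PowerSeries.coeff_map]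
  refine ⟨PowerSeries.coeff n (J i j s) ⊗ₜ ⟨th r i 0 * th r j s, ?_⟩, ?_⟩
  · rw [ExteriorAlgebra.exteriorPower, pow_two]
    exact Submodule.mul_mem_mul ⟨_, rfl⟩ ⟨_, rfl⟩
  · simp

/-- The local bivector `∫ (-½ ∑_{i,j} θ_i J^{ij}(θ_j)) dx` of a (skew-adjoint) matrix
differential operator `J`. -/
def MatDiffOp.bivector {r : ℕ} {M : Opens (Fin r → ℝ)} (J : MatDiffOp r M) : MultiVec r M 2 :=
  ⟨integral r M J.density, Submodule.mem_map_of_mem J.density_mem⟩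

/-- A Hamiltonian operator: a skew-adjoint matrix differential operator whose bivector is
Poisson. -/
def MatDiffOp.IsHamiltonian {r : ℕ} {M : Opens (Fin r → ℝ)} (J : MatDiffOp r M) : Prop :=
  J.IsSkewAdjoint ∧ IsPoisson J.bivector

/-! ### The operators of the hierarchy -/

/-- `w^l` for `l ∈ ℤ`: a coordinate for `0 ≤ l < r`, `w^r = 1`, and `0` otherwise. -/
def wCoord (r : ℕ) (M : Opens (Fin r → ℝ)) (l : ℤ) : DiffAlg r M :=
  if h : 0 ≤ l ∧ l < r then
    PowerSeries.C (MvPolynomial.C (coord r M ⟨l.toNat, by omega⟩))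
  else if l = r then 1 else 0

/-- `a_l` for `l ∈ ℤ`, with `a_l = 0` if `l < 0` or `l > r`. -/
def aExt {r : ℕ} (a : Fin (r + 1) → ℝ) (l : ℤ) : ℝ :=
  if h : 0 ≤ l ∧ l ≤ r then a ⟨l.toNat, by omega⟩ else 0

/-- `𝒟_l = 2 w^l ∂_x + w^l_x - (ε²/2) a_l ∂_x³`. -/
def opD {r : ℕ} (M : Opens (Fin r → ℝ)) (a : Fin (r + 1) → ℝ) (l : ℤ) : DiffOp r M :=
  Finsupp.single 1 (2 * wCoord r M l) + Finsupp.single 0 (dx r M (wCoord r M l)) -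
    Finsupp.single 3 ((aExt a l / 2) • (PowerSeries.X : DiffAlg r M) ^ 2)

/-- `f_m^{ij} = 1` if `i, j < m`, `-1` if `i, j ≥ m`, and `0` otherwise. -/
def fCoef (m i j : ℕ) : ℝ :=
  if i < m ∧ j < m then 1 else if m ≤ i ∧ m ≤ j then -1 else 0

/-- `(P_m)^{ij} = f_m^{ij} 𝒟_{i+j+1-m}`. -/
def opP {r : ℕ} (M : Opens (Fin r → ℝ)) (a : Fin (r + 1) → ℝ) (m : ℕ) : MatDiffOp r M :=
  fun i j => fCoef m i j • opD M a ((i : ℤ) + j + 1 - m)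

end KdVCH

/-! The operator $P_m$ is built from a commutative product on indices, $i\circ_m
j=f_m^{ij}\,(i+j+1-m)$, and the theorem reduces to one fact about these products. The symmetrised
double product $(i\circ_m j)\circ_n l+(i\circ_n j)\circ_m l$, whose coefficient is `fDouble`, is
totally symmetric in $i,j,l$. This is a compatible-associativity property of the pair
$\circ_n,\circ_m$, and it is checked by cases in `fDouble_swap_right_of_le`.

Because $f_m^{ij}w_x^{i+j+1-m}$ is symmetric while $\theta_i\theta_j$ is antisymmetric, the density
of $P_m$ involves $w$ only through undifferentiated coordinates. Hence $\delta P_m/\delta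
w^k=-\sum_{i+j+1-m=k}f_m^{ij}\theta_i\theta_j^1$, and $\delta P_m/\delta\theta_k=-\sum_j
f_m^{kj}\mathcal D_{k+j+1-m}\theta_j$. In the bracket the sum over $k$ forces $k=i+j+1-m$, or
$i+j+1-n$ in the term with the roles exchanged. Both terms then carry the same index
$N=i+j+l+2-n-m$, which is symmetric in $i,j,l$ (`sum_fInt_smul_trivector`). The bracket density is
therefore $\sum c_{ijl}\,\mathcal D_N(\theta_l)\,\theta_i\theta_j^1$ with $c$ totally symmetric.

Such a sum integrates to zero (`integral_sum_trivector`). The terms $\theta_l^1\theta_i\theta_j^1$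
and $\theta_l\theta_i\theta_j^1$ are antisymmetric in $(j,l)$ and $(i,l)$. Modulo $\partial_x$,
$\theta_l^3\theta_i\theta_j^1$ equals
$-\theta_l^2\theta_i^1\theta_j^1-\theta_l^2\theta_i\theta_j^2$, whose terms are antisymmetric in
$(i,j)$ and $(j,l)$.

Skew-adjointness holds because each $\mathcal D_l$ is skew and the matrix is symmetric in $i,j$.
Linear independence is read off from the coefficients of $\theta_k^1$ in $\delta P_m/\delta\theta_k$
at order $\epsilon^0$. -/

namespace KdVCH

variable {r : ℕ} {M : Opens (Fin r → ℝ)}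

/-! ### The index products and their compatibility. -/

/-- The structure constants `f_m` of the hierarchy, with indices in `ℤ`. -/
def fInt (m i j : ℤ) : ℝ :=
  if i < m ∧ j < m then 1 else if m ≤ i ∧ m ≤ j then -1 else 0

theorem fCoef_eq_fInt (m i j : ℕ) : fCoef m i j = fInt m i j := by
  simp [fCoef, fInt]

theorem fInt_comm (m i j : ℤ) : fInt m i j = fInt m j i := by
  simp [fInt, and_comm]

/-- The symmetrised double product `(i ∘ₘ j) ∘ₙ l + (i ∘ₙ j) ∘ₘ l` for the products
`i ∘ₘ j = f_m^{ij} (i + j + 1 - m)`. -/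
def fDouble (n m i j l : ℤ) : ℝ :=
  fInt m i j * fInt n (i + j + 1 - m) l + fInt n i j * fInt m (i + j + 1 - n) l

theorem fDouble_swap_left (n m i j l : ℤ) : fDouble n m i j l = fDouble n m j i l := by
  simp only [fDouble, fInt_comm _ i j, add_comm i j]

theorem fDouble_comm (n m i j l : ℤ) : fDouble n m i j l = fDouble m n i j l := by
  simp only [fDouble, add_comm]

/-- The value depends only on how $i,j,l$ and the two intermediate indices compare with $n$ and $m$,
so it is a finite check. Assuming $n\le m$ halves the work; `fDouble_comm` supplies the other order.
-/
theorem fDouble_swap_right_of_le {n m : ℤ} (h : n ≤ m) (i j l : ℤ) :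
    fDouble n m i j l = fDouble n m i l j := by
  simp only [fDouble, fInt]
  rcases lt_or_ge i n with hi | hi <;> rcases lt_or_ge i m with hi' | hi' <;>
  rcases lt_or_ge j n with hj | hj <;> rcases lt_or_ge j m with hj' | hj' <;>
  rcases lt_or_ge l n with hl | hl <;> rcases lt_or_ge l m with hl' | hl' <;>
  -- `omega` discards the impossible orderings (below $n$ yet at least $m$). In the others the
  -- conditions on $i,j,l$ are evaluated, leaving `split_ifs` to decide only where the intermediate
  -- indices lie.
  first
  | omega
  | (simp only [hi, hi', hj, hj', hl, hl', not_lt.2, not_le.2, and_true, and_false, if_true, if_false]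
     split_ifs <;> first | omega | norm_num)

theorem fDouble_swap_right (n m i j l : ℤ) : fDouble n m i j l = fDouble n m i l j := by
  rcases le_total n m with h | h
  · exact fDouble_swap_right_of_le h i j l
  · rw [fDouble_comm n m, fDouble_comm n m]
    exact fDouble_swap_right_of_le h i j l

theorem sum_eq_zero_of_antisymm {ι E : Type*} [Fintype ι] [AddCommGroup E] [Module ℝ E]
    (F : ι → ι → E) (h : ∀ i j, F i j = -F j i) : ∑ i, ∑ j, F i j = 0 := by
  have : ∑ i, ∑ j, F i j = -∑ i, ∑ j, F i j := by
    conv_lhs => rw [Finset.sum_comm]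
    simp only [← Finset.sum_neg_distrib]
    exact Finset.sum_congr rfl fun i _ => Finset.sum_congr rfl fun j _ => h j i
  have h2 : (2 : ℝ) • ∑ i, ∑ j, F i j = 0 := by
    rw [two_smul]
    nth_rewrite 1 [this]
    exact neg_add_cancel _
  exact (smul_eq_zero.1 h2).resolve_left two_ne_zero

/-! ### Coefficientwise maps of power series -/

theorem epsMap_C {A B : Type} [Semiring A] [Semiring B] [Algebra ℝ A] [Algebra ℝ B]
    (L : A →ₗ[ℝ] B) (x : A) : epsMap L (PowerSeries.C x) = PowerSeries.C (L x) := by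
  ext n
  simp only [epsMap, LinearMap.coe_mk, AddHom.coe_mk, PowerSeries.coeff_mk, PowerSeries.coeff_C]
  split_ifs <;> simp

theorem coeff_epsMap {A B : Type} [Semiring A] [Semiring B] [Algebra ℝ A] [Algebra ℝ B]
    (L : A →ₗ[ℝ] B) (f : PowerSeries A) (n : ℕ) :
    PowerSeries.coeff n (epsMap L f) = L (PowerSeries.coeff n f) := by
  simp [epsMap]

theorem epsMap_X_pow_mul {A B : Type} [Semiring A] [Semiring B] [Algebra ℝ A] [Algebra ℝ B]
    (L : A →ₗ[ℝ] B) (k : ℕ) (f : PowerSeries A) :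
    epsMap L (PowerSeries.X ^ k * f) = PowerSeries.X ^ k * epsMap L f := by
  ext n
  simp only [coeff_epsMap, PowerSeries.coeff_X_pow_mul']
  split_ifs <;> simp

theorem epsMap_C_mul {A : Type} [Semiring A] [Algebra ℝ A] (L : A →ₗ[ℝ] A) (b c : A)
    (h : ∀ x, L (b * x) = c * x + b * L x) (f : PowerSeries A) :
    epsMap L (PowerSeries.C b * f) = PowerSeries.C c * f + PowerSeries.C b * epsMap L f := by
  ext n
  simp [coeff_epsMap, PowerSeries.coeff_C_mul, h]

/-! ### The coordinates as differential polynomials -/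

/-- `w^l` for `l ∈ ℤ`, as a differential polynomial. -/
def wPoly (r : ℕ) (M : Opens (Fin r → ℝ)) (l : ℤ) : DiffPoly r M :=
  if h : 0 ≤ l ∧ l < r then MvPolynomial.C (coord r M ⟨l.toNat, by omega⟩)
  else if l = r then 1 else 0

theorem wCoord_eq (l : ℤ) : wCoord r M l = PowerSeries.C (wPoly r M l) := by
  unfold wCoord wPoly
  split_ifs <;> simp

theorem wPoly_coord (k : Fin r) : wPoly r M k = MvPolynomial.C (coord r M k) := by
  have h : (0 : ℤ) ≤ (k : ℤ) ∧ ((k : ℕ) : ℤ) < r := by omega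
  rw [wPoly, dif_pos h]
  rfl

theorem wPoly_eq_zero {l : ℤ} (h : l < 0 ∨ (r : ℤ) < l) : wPoly r M l = 0 := by
  rw [wPoly, dif_neg (by omega), if_neg (by omega)]

theorem aExt_eq_zero (a : Fin (r + 1) → ℝ) {l : ℤ} (h : l < 0 ∨ (r : ℤ) < l) : aExt a l = 0 := by
  rw [aExt, dif_neg (by omega)]

theorem partialSmooth_coord (i j : Fin r) :
    partialSmooth r M i (coord r M j) = if i = j then 1 else 0 := by
  ext x
  rw [partialSmooth_apply,
    (ext0_eventuallyEq (⇑(coord r M j)) (ContinuousLinearMap.proj (R := ℝ) j) (fun _ => rfl)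
      x).fderiv_eq, ContinuousLinearMap.fderiv]
  by_cases h : i = j
  · subst h; simp
  · simp [h, Ne.symm h]

/-- No separate case for $w^r=1$ or $w^l=0$ is needed: $k<r$ is a genuine coordinate index, so $k=l$
already excludes them. -/
theorem dw_zero_wPoly (k : Fin r) (l : ℤ) :
    dw r M k 0 (wPoly r M l) = if (k : ℤ) = l then 1 else 0 := by
  by_cases h : 0 ≤ l ∧ l < r
  · obtain ⟨j, rfl⟩ : ∃ j : Fin r, l = (j : ℕ) := ⟨⟨l.toNat, by omega⟩, by simp [h.1]⟩
    rw [wPoly_coord, dw, coeffDer_C, partialSmooth_coord]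
    by_cases hk : k = j
    · simp [hk]
    · have : (k : ℕ) ≠ j := fun h => hk (Fin.ext h)
      simp [hk, this]
  · have hk : (k : ℤ) ≠ l := by omega
    rw [wPoly, dif_neg h, if_neg hk]
    split_ifs <;> simp

theorem dw_succ_wPoly (k : Fin r) (s : ℕ) (l : ℤ) : dw r M k (s + 1) (wPoly r M l) = 0 := by
  unfold wPoly
  split_ifs <;> simp [dw]

/-! ### Variational derivatives of monomials -/

theorem superD_tmul (b : DiffPoly r M) (x : ThetaAlg r) :
    superD r M (b ⊗ₜ x) = totalD r M b ⊗ₜ x + b ⊗ₜ shiftDer r x := by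
  simp [superD]

/-- No jet $w^{i,s}$ with $s\ge1$ occurs, so only the $s=0$ term of the Euler sum survives and no
$\partial_x$ is applied. -/
theorem superVarW_wPoly_tmul (k : Fin r) (l : ℤ) (x : ThetaAlg r) :
    superVarW r M k (wPoly r M l ⊗ₜ x) = if (k : ℤ) = l then 1 ⊗ₜ x else 0 := by
  change ∑ᶠ s : ℕ, ((-superD r M) ^ s) (superDw r M k s (wPoly r M l ⊗ₜ x)) = _
  rw [finsum_eq_single _ 0]
  · simp only [superDw, LinearMap.rTensor_tmul, Derivation.coeFn_coe, dw_zero_wPoly]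
    split_ifs <;> simp
  · intro s hs
    obtain ⟨t, rfl⟩ := Nat.exists_eq_succ_of_ne_zero hs
    simp [superDw, dw_succ_wPoly]

theorem superVarW_one_tmul (k : Fin r) (x : ThetaAlg r) :
    superVarW r M k (1 ⊗ₜ x) = 0 := by
  change ∑ᶠ s : ℕ, ((-superD r M) ^ s) (superDw r M k s (1 ⊗ₜ x)) = _
  simp [superDw]

theorem dth_th (k : Fin r) (t : ℕ) (j : Fin r) (s : ℕ) :
    dth r k t (th r j s) = if j = k ∧ s = t then 1 else 0 := by
  have h := dth_ι_mul k t (Finsupp.single (j, s) 1) (1 : ThetaAlg r)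
  have h1 : dth r k t (1 : ThetaAlg r) = 0 := by
    rw [← map_one (algebraMap ℝ (ThetaAlg r))]
    exact dth_algebraMap k t 1
  rw [mul_one, h1, mul_zero, sub_zero, Finsupp.single_apply] at h
  rw [th, h]
  simp only [Prod.mk.injEq, ite_smul, one_smul, zero_smul]

theorem dth_th_mul_th (k : Fin r) (t : ℕ) (i j : Fin r) (s s' : ℕ) :
    dth r k t (th r i s * th r j s') =
      (if i = k ∧ s = t then th r j s' else 0) - if j = k ∧ s' = t then th r i s else 0 := by
  have h := dth_ι_mul k t (Finsupp.single (i, s) 1) (th r j s')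
  rw [Finsupp.single_apply] at h
  rw [th, h, ← th, dth_th]
  simp only [Prod.mk.injEq, ite_smul, one_smul, zero_smul, mul_ite, mul_one, mul_zero]

/-- The minus sign comes from moving the left derivative past $\theta_i$. When $i=j=k$ both terms
contribute, even for $s=0$. -/
theorem superVarTh_tmul (k : Fin r) (b : DiffPoly r M) (i j : Fin r) (s : ℕ) :
    superVarTh r M k (b ⊗ₜ (th r i 0 * th r j s)) =
      (if i = k then b ⊗ₜ th r j s else 0) -
        if j = k then ((-superD r M) ^ s) (b ⊗ₜ th r i 0) else 0 := by
  change ∑ᶠ t : ℕ, ((-superD r M) ^ t) (superDth r M k t (b ⊗ₜ (th r i 0 * th r j s))) = _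
  have h : ∀ t, ((-superD r M) ^ t) (superDth r M k t (b ⊗ₜ (th r i 0 * th r j s))) =
      (if t = 0 then (if i = k then b ⊗ₜ th r j s else 0) else 0) -
        if t = s then (if j = k then ((-superD r M) ^ s) (b ⊗ₜ th r i 0) else 0) else 0 := by
    intro t
    rw [superDth, LinearMap.lTensor_tmul, dth_th_mul_th, TensorProduct.tmul_sub, map_sub]
    congr 1
    · by_cases ht : t = 0
      · subst ht; by_cases hi : i = k <;> simp [hi]
      · simp [ht, Ne.symm ht]
    · by_cases ht : t = s
      · subst ht; by_cases hi : j = k <;> simp [hi]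
      · simp [ht, Ne.symm ht]
  simp only [h]
  rw [finsum_sub_distrib]
  · rw [finsum_eq_single _ 0 (by intro t ht; simp [ht]), finsum_eq_single _ s
      (by intro t ht; simp [ht])]
    simp
  · exact (Set.finite_singleton 0).subset fun t ht => by
      by_contra h'; exact ht (if_neg h')
  · exact (Set.finite_singleton s).subset fun t ht => by
      by_contra h'; exact ht (if_neg h')

theorem superVarTh_tmul_one (k : Fin r) (b : DiffPoly r M) (i j : Fin r) :
    superVarTh r M k (b ⊗ₜ (th r i 0 * th r j 1)) =
      (if i = k then b ⊗ₜ th r j 1 else 0) +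
        if j = k then totalD r M b ⊗ₜ th r i 0 + b ⊗ₜ th r i 1 else 0 := by
  rw [superVarTh_tmul, pow_one, LinearMap.neg_apply, superD_tmul, shiftDer_th]
  split_ifs <;> abel

/-- The sign of $(-\partial_x)^3$ cancels the one from passing $\theta_i$. The coefficient $1$ keeps
the Leibniz rule from producing further terms. -/
theorem superVarTh_tmul_three (k : Fin r) (i j : Fin r) :
    superVarTh r M k ((1 : DiffPoly r M) ⊗ₜ (th r i 0 * th r j 3)) =
      (if i = k then 1 ⊗ₜ th r j 3 else 0) + if j = k then 1 ⊗ₜ th r i 3 else 0 := by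
  have h : ((-superD r M) ^ 3) ((1 : DiffPoly r M) ⊗ₜ th r i 0) = -(1 ⊗ₜ th r i 3) := by
    simp [pow_succ, superD_tmul, shiftDer_th]
  rw [superVarTh_tmul, h]
  split_ifs <;> simp

/-! ### Products of super variables -/

local instance instRingSuperPoly : Ring (SuperPoly r M) := inferInstance
local instance instAlgebraSuperPoly : Algebra ℝ (SuperPoly r M) := inferInstance
local instance instRingSuperAlg : Ring (SuperAlg r M) := inferInstance
local instance instAddCommGroupSuperAlg : AddCommGroup (SuperAlg r M) := inferInstance
local instance instAlgebraSuperAlg : Algebra ℝ (SuperAlg r M) := inferInstance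
local instance instModuleSuperAlg : Module ℝ (SuperAlg r M) := inferInstance

theorem th_mul_th_swap (i j : Fin r) (s t : ℕ) : th r i s * th r j t = -(th r j t * th r i s) :=
  eq_neg_of_add_eq_zero_left (ExteriorAlgebra.ι_add_mul_swap _ _)

theorem th_mul_th_mul_th_reverse (i j l : Fin r) (s t u : ℕ) :
    th r l u * (th r i s * th r j t) = -(th r j t * (th r i s * th r l u)) := by
  rw [← mul_assoc, th_mul_th_swap l i, neg_mul, mul_assoc, th_mul_th_swap l j, mul_neg, neg_neg,
    ← mul_assoc, th_mul_th_swap i j, neg_mul, mul_assoc]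

theorem th_mul_th_mul_th_swap (i j l : Fin r) (s t u : ℕ) :
    th r l u * (th r i s * th r j t) = -(th r i s * (th r l u * th r j t)) := by
  rw [← mul_assoc, th_mul_th_swap l i, neg_mul, mul_assoc]

theorem th_mul_th_mul_th_comm (i j l : Fin r) (s t u : ℕ) :
    th r i s * th r j t * th r l u = th r l u * (th r i s * th r j t) := by
  rw [th_mul_th_mul_th_swap, mul_assoc, th_mul_th_swap j l, mul_neg]

/-! ### The operators $\mathcal D_l$ acting on $\theta_j$. -/

/-- An element of `𝒜̂` of order `ε⁰`. -/
def const (b : DiffPoly r M) (x : ThetaAlg r) : SuperAlg r M := PowerSeries.C (b ⊗ₜ x)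

theorem const_mul (b b' : DiffPoly r M) (x x' : ThetaAlg r) :
    const b x * const b' x' = const (b * b') (x * x') := by
  simp [const, ← map_mul]

theorem const_neg (b : DiffPoly r M) (x : ThetaAlg r) : const b (-x) = -const b x := by
  simp [const, TensorProduct.tmul_neg]

theorem theta_eq (i : Fin r) (s : ℕ) : theta r M i s = const 1 (th r i s) := rfl

theorem sdx_const (b : DiffPoly r M) (x : ThetaAlg r) :
    sdx r M (const b x) = const (totalD r M b) x + const b (shiftDer r x) := by
  rw [sdx, const, epsMap_C, superD_tmul, map_add]
  rfl

theorem dx_wCoord (l : ℤ) : dx r M (wCoord r M l) = PowerSeries.C (totalD r M (wPoly r M l)) := by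
  rw [wCoord_eq, dx, epsMap_C]
  rfl

theorem incl_C (b : DiffPoly r M) : incl r M (PowerSeries.C b) = const b 1 := by
  simp [incl, const]

theorem incl_X : incl r M PowerSeries.X = PowerSeries.X := PowerSeries.map_X _

theorem map_smul_of_real {A B : Type} [Semiring A] [Semiring B] [Algebra ℝ A] [Algebra ℝ B]
    (f : A →+* B) (hf : ∀ (c : ℝ) x, f (c • x) = c • f x) (c : ℝ) (φ : PowerSeries A) :
    PowerSeries.map f (c • φ) = c • PowerSeries.map f φ := by
  ext n
  change PowerSeries.coeff n (PowerSeries.map f (c • φ)) =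
    c • PowerSeries.coeff n (PowerSeries.map f φ)
  rw [PowerSeries.coeff_map, PowerSeries.coeff_map, ← hf]
  rfl

theorem incl_smul (c : ℝ) (φ : DiffAlg r M) : incl r M (c • φ) = c • incl r M φ :=
  map_smul_of_real _ (fun _ _ => rfl) c φ

theorem superAct_smul (c : ℝ) (P : DiffOp r M) (φ : SuperAlg r M) :
    (c • P).superAct φ = c • P.superAct φ := by
  rw [DiffOp.superAct, Finsupp.sum_smul_index' (by simp), DiffOp.superAct, Finsupp.smul_sum]
  refine Finsupp.sum_congr fun s _ => ?_
  rw [← smul_mul_assoc, incl_smul]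

/-- `𝒟_l θ_j`. -/
def dTheta (M : Opens (Fin r → ℝ)) (a : Fin (r + 1) → ℝ) (l : ℤ) (j : Fin r) : SuperAlg r M :=
  (2 : ℝ) • const (wPoly r M l) (th r j 1) + const (totalD r M (wPoly r M l)) (th r j 0) -
    (aExt a l / 2) • (PowerSeries.X ^ 2 * const 1 (th r j 3))

theorem opD_superAct (a : Fin (r + 1) → ℝ) (l : ℤ) (j : Fin r) :
    (opD M a l).superAct (theta r M j 0) = dTheta M a l j := by
  have h2 : incl r M (2 * wCoord r M l) = (2 : ℝ) • const (wPoly r M l) 1 := by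
    rw [map_mul, wCoord_eq, incl_C, map_ofNat, two_mul, two_smul]
  rw [opD, DiffOp.superAct, Finsupp.sum_sub_index (by intros; simp only [map_sub, sub_mul]),
    Finsupp.sum_add_index' (by simp) (by intros; simp only [map_add, add_mul]),
    Finsupp.sum_single_index (by simp), Finsupp.sum_single_index (by simp),
    Finsupp.sum_single_index (by simp), incl_smul, map_pow, incl_X, h2, dx_wCoord, incl_C,
    sdx_pow_theta, sdx_pow_theta, sdx_pow_theta]
  simp only [theta_eq, smul_mul_assoc, const_mul, mul_one, one_mul, dTheta]

theorem dTheta_eq_zero (a : Fin (r + 1) → ℝ) {l : ℤ} (h : l < 0 ∨ (r : ℤ) < l) (j : Fin r) :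
    dTheta M a l j = 0 := by
  simp [dTheta, wPoly_eq_zero h, aExt_eq_zero a h, const]

/-! ### Densities and variational derivatives of the bivectors. -/

/-- A density of the bivector of `P_m` free of `w^{l,1}`. -/
def reducedDensity (M : Opens (Fin r → ℝ)) (a : Fin (r + 1) → ℝ) (m : ℕ) : SuperAlg r M :=
  ∑ i : Fin r, ∑ j : Fin r, fInt m i j •
    ((aExt a (i + j + 1 - m) / 4) • (PowerSeries.X ^ 2 * const 1 (th r i 0 * th r j 3)) -
      const (wPoly r M (i + j + 1 - m)) (th r i 0 * th r j 1))

/-- The equality holds already for densities, not only modulo $\partial_x$: the terms in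
$w_x\theta_i\theta_j$ cancel in pairs under $i\leftrightarrow j$. -/
theorem density_opP (a : Fin (r + 1) → ℝ) (m : ℕ) :
    (opP M a m).density = reducedDensity M a m := by
  have hz : ∑ i : Fin r, ∑ j : Fin r, fInt m i j •
      const (totalD r M (wPoly r M (i + j + 1 - m))) (th r i 0 * th r j 0) = 0 := by
    apply sum_eq_zero_of_antisymm
    intro i j
    rw [th_mul_th_swap, const_neg, smul_neg, fInt_comm, add_comm (i : ℤ) j]
  suffices h : (opP M a m).density = reducedDensity M a m + (-(1 / 2) : ℝ) •
      ∑ i : Fin r, ∑ j : Fin r, fInt m i j •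
        const (totalD r M (wPoly r M (i + j + 1 - m))) (th r i 0 * th r j 0) by
    rw [h, hz, smul_zero, add_zero]
  rw [MatDiffOp.density, reducedDensity]
  simp only [Finset.smul_sum, ← Finset.sum_add_distrib]
  refine Finset.sum_congr rfl fun i _ => Finset.sum_congr rfl fun j _ => ?_
  rw [opP, superAct_smul, opD_superAct, dTheta, theta_eq, fCoef_eq_fInt]
  have hX : const 1 (th r i 0) * (PowerSeries.X ^ 2 * const (1 : DiffPoly r M) (th r j 3)) =
      PowerSeries.X ^ 2 * const 1 (th r i 0 * th r j 3) := by
    rw [← mul_assoc, (PowerSeries.commute_X_pow (const 1 (th r i 0)) 2).eq, mul_assoc, const_mul, one_mul]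
  simp only [mul_smul_comm, mul_sub, mul_add, hX, const_mul, one_mul]
  module

theorem varTh_integral (k : Fin r) (f : SuperAlg r M) :
    varTh r M k (integral r M f) = epsMap (superVarTh r M k) f := rfl

theorem varW_integral (k : Fin r) (f : SuperAlg r M) :
    varW r M k (integral r M f) = epsMap (superVarW r M k) f := rfl

/-- The derivative hits either the first or the second $\theta$ of the quadratic density. Symmetry
of $f_m$ lets the two contributions be combined; the $w_x\theta$ term of $\mathcal D$, absent from
the reduced density, returns from the integration by parts in the second. -/
theorem varTh_opP (a : Fin (r + 1) → ℝ) (m : ℕ) (k : Fin r) :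
    varTh r M k ((opP M a m).bivector : Functional r M) =
      -∑ j : Fin r, fInt m k j • dTheta M a (k + j + 1 - m) j := by
  have key : ∀ i j : Fin r, epsMap (superVarTh r M k) (fInt m i j •
      ((aExt a (i + j + 1 - m) / 4) • (PowerSeries.X ^ 2 * const 1 (th r i 0 * th r j 3)) -
        const (wPoly r M (i + j + 1 - m)) (th r i 0 * th r j 1))) =
      (if i = k then fInt m k j • ((aExt a (k + j + 1 - m) / 4) •
        (PowerSeries.X ^ 2 * const 1 (th r j 3)) -
          const (wPoly r M (k + j + 1 - m)) (th r j 1)) else 0) +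
      (if j = k then fInt m k i • ((aExt a (k + i + 1 - m) / 4) •
        (PowerSeries.X ^ 2 * const 1 (th r i 3)) -
          const (totalD r M (wPoly r M (k + i + 1 - m))) (th r i 0) -
          const (wPoly r M (k + i + 1 - m)) (th r i 1)) else 0) := by
    intro i j
    rw [map_smul, map_sub, map_smul, epsMap_X_pow_mul, const, const, epsMap_C, epsMap_C,
      superVarTh_tmul_one, superVarTh_tmul_three]
    by_cases hi : i = k <;> by_cases hj : j = k
    · subst hi; subst hj
      simp only [if_true, map_add, mul_add, const]
      module
    · subst hi
      simp only [if_true, if_neg hj, add_zero, const]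
    · subst hj
      simp only [if_true, if_neg hi, zero_add, const, fInt_comm m i j, add_comm (i : ℤ) j, map_add]
      module
    · simp [hi, hj]
  change varTh r M k (integral r M (opP M a m).density) = _
  rw [density_opP, varTh_integral, reducedDensity, map_sum]
  simp only [map_sum, key, Finset.sum_add_distrib]
  -- The contribution with $i=k$ needs its sums exchanged so that the constrained index is
  -- innermost.
  rw [Finset.sum_comm]
  simp only [Finset.sum_ite_eq', Finset.mem_univ, if_true]
  rw [← Finset.sum_add_distrib, ← Finset.sum_neg_distrib]
  refine Finset.sum_congr rfl fun j _ => ?_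
  rw [dTheta]
  module

theorem varW_opP (a : Fin (r + 1) → ℝ) (m : ℕ) (k : Fin r) :
    varW r M k ((opP M a m).bivector : Functional r M) =
      -∑ i : Fin r, ∑ j : Fin r, if (k : ℤ) = i + j + 1 - m then
        fInt m i j • const 1 (th r i 0 * th r j 1) else 0 := by
  change varW r M k (integral r M (opP M a m).density) = _
  rw [density_opP, varW_integral, reducedDensity, map_sum]
  simp only [map_sum, ← Finset.sum_neg_distrib]
  refine Finset.sum_congr rfl fun i _ => Finset.sum_congr rfl fun j _ => ?_
  rw [map_smul, map_sub, map_smul, epsMap_X_pow_mul, const, const, epsMap_C, epsMap_C,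
    superVarW_wPoly_tmul, superVarW_one_tmul]
  split_ifs <;> simp [const]

/-! ### The Schouten brackets -/

/-- `𝒟_N(θ_l) θ_i θ_j^1`. -/
def trivector (M : Opens (Fin r → ℝ)) (a : Fin (r + 1) → ℝ) (N : ℤ) (i j l : Fin r) :
    SuperAlg r M :=
  (2 : ℝ) • const (wPoly r M N) (th r l 1 * (th r i 0 * th r j 1)) +
    const (totalD r M (wPoly r M N)) (th r l 0 * (th r i 0 * th r j 1)) -
    (aExt a N / 2) • (PowerSeries.X ^ 2 * const 1 (th r l 3 * (th r i 0 * th r j 1)))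

theorem dTheta_mul (a : Fin (r + 1) → ℝ) (N : ℤ) (i j l : Fin r) :
    dTheta M a N l * const 1 (th r i 0 * th r j 1) = trivector M a N i j l := by
  simp only [dTheta, trivector, sub_mul, add_mul, smul_mul_assoc, const_mul, mul_one, mul_assoc]

theorem mul_dTheta (a : Fin (r + 1) → ℝ) (N : ℤ) (i j l : Fin r) :
    const 1 (th r i 0 * th r j 1) * dTheta M a N l = trivector M a N i j l := by
  have hX (x : ThetaAlg r) : const 1 (th r i 0 * th r j 1) *
      (PowerSeries.X ^ 2 * const (1 : DiffPoly r M) x) =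
      PowerSeries.X ^ 2 * const 1 (th r i 0 * th r j 1 * x) := by
    rw [← mul_assoc, (PowerSeries.commute_X_pow (const 1 (th r i 0 * th r j 1)) 2).eq, mul_assoc,
      const_mul, one_mul]
  simp only [dTheta, trivector, mul_sub, mul_add, mul_smul_comm, hX, const_mul, one_mul,
    th_mul_th_mul_th_comm]

theorem trivector_eq_zero (a : Fin (r + 1) → ℝ) {N : ℤ} (h : N < 0 ∨ (r : ℤ) < N)
    (i j l : Fin r) : trivector M a N i j l = 0 := by
  rw [← dTheta_mul, dTheta_eq_zero a h, zero_mul]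

/-- The sum over the intermediate index of a double product collapses. -/
theorem sum_fInt_smul_trivector (a : Fin (r + 1) → ℝ) {n m : ℕ} (hn : n ≤ r)
    (i j l : Fin r) :
    ∑ k : Fin r, (if (k : ℤ) = i + j + 1 - m then
      (fInt m i j * fInt n k l) • trivector M a (k + l + 1 - n) i j l else 0) =
    (fInt m i j * fInt n (i + j + 1 - m) l) •
      trivector M a (i + j + l + 2 - n - m) i j l := by
  -- Inside the range exactly one $k$ contributes. Outside it the left side is empty, so the right
  -- side must vanish by itself.
  by_cases hq : 0 ≤ (i + j + 1 - m : ℤ) ∧ (i + j + 1 - m : ℤ) < r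
  · obtain ⟨q, hq'⟩ : ∃ q : Fin r, ((q : ℕ) : ℤ) = i + j + 1 - m :=
      ⟨⟨(i + j + 1 - m : ℤ).toNat, by omega⟩, Int.toNat_of_nonneg hq.1⟩
    rw [Finset.sum_eq_single q, if_pos hq', hq']
    · congr 2; ring
    · intro k _ hk
      rw [if_neg]
      intro h
      exact hk (Fin.ext (by omega))
    · exact fun h => absurd (Finset.mem_univ q) h
  · rw [Finset.sum_eq_zero fun k _ => if_neg (by omega)]
    -- With $k=i+j+1-m$ out of range and $N=k+l+1-n$, either $k$ and $l$ lie on opposite sides of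
    -- $n$, so that $f_n^{kl}=0$, or they lie on the same side and $N$ falls outside $[0,r]$, so
    -- that $\mathcal D_N=0$. Separating $k\ge r$ from $l<n$ uses $n\le r$.
    by_cases hl : (l : ℤ) < n
    · by_cases h0 : (i + j + 1 - m : ℤ) < 0
      · rw [trivector_eq_zero a (by omega), smul_zero]
      · have : fInt n (i + j + 1 - m) l = 0 := by
          rw [fInt, if_neg (by omega), if_neg (by omega)]
        rw [this, mul_zero, zero_smul]
    · by_cases h0 : (i + j + 1 - m : ℤ) < 0
      · have : fInt n (i + j + 1 - m) l = 0 := by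
          rw [fInt, if_neg (by omega), if_neg (by omega)]
        rw [this, mul_zero, zero_smul]
      · rw [trivector_eq_zero a (by omega), smul_zero]

theorem sum_dTheta_mul_sum (a : Fin (r + 1) → ℝ) {n : ℕ} (hn : n ≤ r) (m : ℕ) :
    ∑ k : Fin r, (∑ l : Fin r, fInt n k l • dTheta M a (k + l + 1 - n) l) *
      (∑ i : Fin r, ∑ j : Fin r, if (k : ℤ) = i + j + 1 - m then
        fInt m i j • const 1 (th r i 0 * th r j 1) else 0) =
    ∑ i : Fin r, ∑ j : Fin r, ∑ l : Fin r, (fInt m i j * fInt n (i + j + 1 - m) l) •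
      trivector M a (i + j + l + 2 - n - m) i j l := by
  simp only [← sum_fInt_smul_trivector a hn, Finset.mul_sum, Finset.sum_mul]
  rw [Finset.sum_comm]
  refine Finset.sum_congr rfl fun i _ => ?_
  rw [Finset.sum_comm]
  refine Finset.sum_congr rfl fun j _ => ?_
  rw [Finset.sum_comm]
  refine Finset.sum_congr rfl fun l _ => Finset.sum_congr rfl fun k _ => ?_
  split_ifs
  · rw [smul_mul_smul_comm, dTheta_mul, mul_comm]
  · rw [mul_zero]

/-- The quadratic factor is even in the super variables, hence commutes with $\mathcal D\theta_l$;
the order of the factors is immaterial. -/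
theorem sum_mul_sum_dTheta (a : Fin (r + 1) → ℝ) {n : ℕ} (hn : n ≤ r) (m : ℕ) :
    ∑ k : Fin r, (∑ i : Fin r, ∑ j : Fin r, if (k : ℤ) = i + j + 1 - m then
        fInt m i j • const 1 (th r i 0 * th r j 1) else 0) *
      (∑ l : Fin r, fInt n k l • dTheta M a (k + l + 1 - n) l) =
    ∑ i : Fin r, ∑ j : Fin r, ∑ l : Fin r, (fInt m i j * fInt n (i + j + 1 - m) l) •
      trivector M a (i + j + l + 2 - n - m) i j l := by
  rw [← sum_dTheta_mul_sum a hn]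
  refine Finset.sum_congr rfl fun k _ => Commute.eq ?_
  refine Commute.sum_left _ _ _ fun i _ => Commute.sum_left _ _ _ fun j _ =>
    Commute.sum_right _ _ _ fun l _ => Commute.smul_right ?_ _
  split_ifs
  · exact Commute.smul_left ((mul_dTheta a _ i j l).trans (dTheta_mul a _ i j l).symm) _
  · exact Commute.zero_left _

/-- A totally symmetric coefficient annihilates everything antisymmetric in two indices. After one
integration by parts of the $\theta_l^3$ term, every remaining term is antisymmetric in some pair.
-/
theorem integral_sum_trivector (a : Fin (r + 1) → ℝ) (c : ℤ → ℤ → ℤ → ℝ)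
    (h1 : ∀ i j l, c i j l = c j i l) (h2 : ∀ i j l, c i j l = c i l j) (d : ℤ) :
    integral r M (∑ i : Fin r, ∑ j : Fin r, ∑ l : Fin r,
      c i j l • trivector M a (i + j + l + d) i j l) = 0 := by
  have h3 : ∀ i j l, c i j l = c l j i := fun i j l => by rw [h1, h2, h1]
  have e2 (i j l : Fin r) : (i + j + l + d : ℤ) = i + l + j + d := by ring
  have e3 (i j l : Fin r) : (i + j + l + d : ℤ) = l + j + i + d := by ring
  have z1 : ∑ i : Fin r, ∑ j : Fin r, ∑ l : Fin r, c i j l •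
      const (wPoly r M (i + j + l + d)) (th r l 1 * (th r i 0 * th r j 1)) = 0 :=
    Finset.sum_eq_zero fun i _ => sum_eq_zero_of_antisymm _ fun j l => by
      rw [th_mul_th_mul_th_reverse, const_neg, smul_neg, h2, e2]
  have z2 : ∑ i : Fin r, ∑ j : Fin r, ∑ l : Fin r, c i j l •
      const (totalD r M (wPoly r M (i + j + l + d))) (th r l 0 * (th r i 0 * th r j 1)) = 0 := by
    rw [Finset.sum_comm]
    exact Finset.sum_eq_zero fun j _ => sum_eq_zero_of_antisymm _ fun i l => by
      rw [th_mul_th_mul_th_swap, const_neg, smul_neg, h3, e3]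
  have z3 : ∑ i : Fin r, ∑ j : Fin r, ∑ l : Fin r, (c i j l * (aExt a (i + j + l + d) / 2)) •
      (PowerSeries.X ^ 2 * const (1 : DiffPoly r M) (th r l 2 * (th r i 1 * th r j 1))) = 0 := by
    conv_lhs => enter [2, i]; rw [Finset.sum_comm]
    rw [Finset.sum_comm]
    exact Finset.sum_eq_zero fun l _ => sum_eq_zero_of_antisymm _ fun i j => by
      rw [th_mul_th_swap i j, mul_neg, const_neg, mul_neg, smul_neg, h1, add_comm (i : ℤ) j]
  have z4 : ∑ i : Fin r, ∑ j : Fin r, ∑ l : Fin r, (c i j l * (aExt a (i + j + l + d) / 2)) •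
      (PowerSeries.X ^ 2 * const (1 : DiffPoly r M) (th r l 2 * (th r i 0 * th r j 2))) = 0 :=
    Finset.sum_eq_zero fun i _ => sum_eq_zero_of_antisymm _ fun j l => by
      rw [th_mul_th_mul_th_reverse, const_neg, mul_neg, smul_neg, h2, e2]
  -- The subtracted exact term is chosen so that its $\theta_l^3\theta_i\theta_j^1$ part reproduces
  -- the dispersive term. Since $a_N$ is constant, its derivative yields only the other two
  -- monomials, which are cancelled by the added ones.
  have key (i j l : Fin r) : c i j l • trivector M a (i + j + l + d) i j l =
      (2 : ℝ) • c i j l • const (wPoly r M (i + j + l + d)) (th r l 1 * (th r i 0 * th r j 1)) +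
      c i j l • const (totalD r M (wPoly r M (i + j + l + d)))
        (th r l 0 * (th r i 0 * th r j 1)) +
      (c i j l * (aExt a (i + j + l + d) / 2)) •
        (PowerSeries.X ^ 2 * const (1 : DiffPoly r M) (th r l 2 * (th r i 1 * th r j 1))) +
      (c i j l * (aExt a (i + j + l + d) / 2)) •
        (PowerSeries.X ^ 2 * const (1 : DiffPoly r M) (th r l 2 * (th r i 0 * th r j 2))) -
      sdx r M ((c i j l * (aExt a (i + j + l + d) / 2)) •
        (PowerSeries.X ^ 2 * const (1 : DiffPoly r M) (th r l 2 * (th r i 0 * th r j 1)))) := by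
    have hd : const (1 : DiffPoly r M) (shiftDer r (th r l 2 * (th r i 0 * th r j 1))) =
        const 1 (th r l 3 * (th r i 0 * th r j 1)) + const 1 (th r l 2 * (th r i 1 * th r j 1)) +
        const 1 (th r l 2 * (th r i 0 * th r j 2)) := by
      simp only [shiftDer_mul, shiftDer_th, mul_add, const, TensorProduct.tmul_add, map_add]
      abel
    have h0 (x : ThetaAlg r) : const (0 : DiffPoly r M) x = 0 := by simp [const]
    have hX (f : SuperAlg r M) : sdx r M (PowerSeries.X ^ 2 * f) = PowerSeries.X ^ 2 * sdx r M f :=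
      epsMap_X_pow_mul _ _ _
    rw [map_smul, hX, sdx_const, Derivation.map_one_eq_zero, h0, zero_add, hd, trivector,
      mul_add, mul_add]
    module
  simp only [key, Finset.sum_add_distrib, Finset.sum_sub_distrib, ← Finset.smul_sum, z1, z2, z3,
    z4, ← map_sum, smul_zero, add_zero, zero_sub]
  rw [map_neg, neg_eq_zero]
  exact (Submodule.Quotient.mk_eq_zero _).2 ⟨_, rfl⟩

theorem schouten_opP (a : Fin (r + 1) → ℝ) {n m : ℕ} (hn : n ≤ r) (hm : m ≤ r) :
    schouten (opP M a n).bivector (opP M a m).bivector = 0 := by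
  have e1 (i j l : Fin r) : (i + j + l + 2 - m - n : ℤ) = i + j + l + (2 - n - m) := by ring
  have e2 (i j l : Fin r) : (i + j + l + 2 - n - m : ℤ) = i + j + l + (2 - n - m) := by ring
  rw [schouten]
  simp only [varTh_opP, varW_opP, neg_mul_neg, neg_one_sq, one_smul, Finset.sum_add_distrib]
  rw [sum_dTheta_mul_sum a hn, sum_mul_sum_dTheta a hm]
  simp only [← Finset.sum_add_distrib, e1, e2, ← add_smul]
  -- The two halves of the bracket add up to the coefficient `fDouble n m`, on the common index
  -- $i+j+l+(2-n-m)$.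
  exact integral_sum_trivector a (fDouble n m) (fDouble_swap_left _ _) (fDouble_swap_right _ _) _

/-! ### Skew-adjointness -/

theorem dx_C_mul (b : DiffPoly r M) (φ : DiffAlg r M) :
    dx r M (PowerSeries.C b * φ) =
      PowerSeries.C (totalD r M b) * φ + PowerSeries.C b * dx r M φ :=
  epsMap_C_mul _ _ _ (fun x => by
    change totalD r M (b * x) = _ + b * totalD r M x
    rw [Derivation.leibniz, smul_eq_mul, smul_eq_mul]
    ring) φ

theorem dx_X_pow_mul (k : ℕ) (φ : DiffAlg r M) :
    dx r M (PowerSeries.X ^ k * φ) = PowerSeries.X ^ k * dx r M φ :=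
  epsMap_X_pow_mul _ _ _

/-- The adjoint of $2w\partial_x+w_x$ is $-2\partial_x\circ w+w_x=-2w\partial_x-w_x$, and
$\partial_x^3$ is skew with constant coefficient. -/
theorem opD_act_add_adjAct (a : Fin (r + 1) → ℝ) (l : ℤ) (φ : DiffAlg r M) :
    (opD M a l).act φ + (opD M a l).adjAct φ = 0 := by
  have hact : (opD M a l).act φ = 2 * wCoord r M l * dx r M φ + dx r M (wCoord r M l) * φ -
      (aExt a l / 2) • (PowerSeries.X ^ 2 * dx r M (dx r M (dx r M φ))) := by
    rw [opD, DiffOp.act, Finsupp.sum_sub_index (by intros; simp only [sub_mul]),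
      Finsupp.sum_add_index' (by simp) (by intros; simp only [add_mul]),
      Finsupp.sum_single_index (by simp), Finsupp.sum_single_index (by simp),
      Finsupp.sum_single_index (by simp), smul_mul_assoc]
    rfl
  have hadj : (opD M a l).adjAct φ = -dx r M (2 * wCoord r M l * φ) + dx r M (wCoord r M l) * φ +
      (aExt a l / 2) • (PowerSeries.X ^ 2 * dx r M (dx r M (dx r M φ))) := by
    rw [opD, DiffOp.adjAct, Finsupp.sum_sub_index (by intros; simp only [sub_mul, map_sub]),
      Finsupp.sum_add_index' (by simp) (by intros; simp only [add_mul, map_add]),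
      Finsupp.sum_single_index (by simp), Finsupp.sum_single_index (by simp),
      Finsupp.sum_single_index (by simp), smul_mul_assoc, map_smul]
    simp only [pow_succ, pow_zero, one_mul, Module.End.mul_apply, Module.End.one_apply,
      LinearMap.neg_apply, map_neg, neg_neg]
    rw [← pow_two, dx_X_pow_mul, dx_X_pow_mul, dx_X_pow_mul, smul_neg, sub_neg_eq_add]
  have h2 : dx r M (2 * wCoord r M l * φ) =
      2 * dx r M (wCoord r M l) * φ + 2 * wCoord r M l * dx r M φ := by
    rw [mul_assoc, two_mul, map_add, wCoord_eq, dx_C_mul, ← wCoord_eq, ← dx_wCoord]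
    ring
  rw [hact, hadj, h2]
  ring

theorem act_smul (c : ℝ) (P : DiffOp r M) (φ : DiffAlg r M) :
    (c • P).act φ = c • P.act φ := by
  rw [DiffOp.act, Finsupp.sum_smul_index' (by simp), DiffOp.act, Finsupp.smul_sum]
  exact Finsupp.sum_congr fun s _ => smul_mul_assoc _ _ _

theorem adjAct_smul (c : ℝ) (P : DiffOp r M) (φ : DiffAlg r M) :
    (c • P).adjAct φ = c • P.adjAct φ := by
  rw [DiffOp.adjAct, Finsupp.sum_smul_index' (by simp), DiffOp.adjAct, Finsupp.smul_sum]
  refine Finsupp.sum_congr fun s _ => ?_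
  rw [smul_mul_assoc, map_smul]

/-- Both $f_m^{ij}$ and the index $i+j+1-m$ are symmetric, so the matrix inherits skewness entry by
entry. -/
theorem opP_isSkewAdjoint (a : Fin (r + 1) → ℝ) (m : ℕ) : (opP M a m).IsSkewAdjoint := by
  intro i j φ
  rw [opP, opP, act_smul, adjAct_smul, fCoef_eq_fInt, fCoef_eq_fInt, fInt_comm m j i,
    add_comm (j : ℤ) i, ← smul_add, opD_act_add_adjAct, smul_zero]

/-! ### Linear independence -/

/-- The coefficient of `θ_j^s` in degree one, at order `ε⁰`. -/
def thetaCoeff (M : Opens (Fin r → ℝ)) (j : Fin r) (s : ℕ) : SuperAlg r M →ₗ[ℝ] DiffPoly r M where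
  toFun f := TensorProduct.rid ℝ (DiffPoly r M)
    (LinearMap.lTensor (DiffPoly r M) ((ExteriorAlgebra.algebraMapInv.toLinearMap :
      ThetaAlg r →ₗ[ℝ] ℝ) ∘ₗ dth r j s) (PowerSeries.coeff 0 f))
  map_add' f g := by simp only [map_add]
  map_smul' c f := by
    change TensorProduct.rid ℝ (DiffPoly r M) (LinearMap.lTensor (DiffPoly r M) _
      (c • PowerSeries.coeff 0 f)) = _
    simp only [map_smul, RingHom.id_apply]

theorem thetaCoeff_const (j : Fin r) (s : ℕ) (b : DiffPoly r M) (i : Fin r) (t : ℕ) :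
    thetaCoeff M j s (const b (th r i t)) = if i = j ∧ t = s then b else 0 := by
  change TensorProduct.rid ℝ (DiffPoly r M) (LinearMap.lTensor (DiffPoly r M) _
    (PowerSeries.coeff 0 (PowerSeries.C (b ⊗ₜ[ℝ] th r i t)))) = _
  rw [PowerSeries.coeff_zero_C, LinearMap.lTensor_tmul, LinearMap.comp_apply, dth_th]
  split_ifs <;> simp

theorem thetaCoeff_X_pow_mul (j : Fin r) (s : ℕ) (f : SuperAlg r M) :
    thetaCoeff M j s (PowerSeries.X ^ 2 * f) = 0 := by
  change TensorProduct.rid ℝ (DiffPoly r M) (LinearMap.lTensor (DiffPoly r M) _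
    (PowerSeries.coeff 0 (PowerSeries.X ^ 2 * f))) = 0
  rw [PowerSeries.coeff_X_pow_mul']
  simp

theorem thetaCoeff_dTheta (a : Fin (r + 1) → ℝ) (j : Fin r) (l : ℤ) (i : Fin r) :
    thetaCoeff M j 1 (dTheta M a l i) = if i = j then (2 : ℝ) • wPoly r M l else 0 := by
  rw [dTheta, map_sub, map_add, map_smul, map_smul, thetaCoeff_const, thetaCoeff_const,
    thetaCoeff_X_pow_mul]
  simp

/-- Variational derivatives are well defined on $\hat\Lambda$, so this turns a linear relation
between bivectors into one between the $w^l$. -/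
theorem thetaCoeff_varTh_opP (a : Fin (r + 1) → ℝ) (m : ℕ) (k j : Fin r) :
    thetaCoeff M j 1 (varTh r M k ((opP M a m).bivector : Functional r M)) =
      (-(2 * fInt m k j)) • wPoly r M (k + j + 1 - m) := by
  rw [varTh_opP, map_neg, map_sum]
  simp only [map_smul, thetaCoeff_dTheta, smul_ite, smul_zero, Finset.sum_ite_eq',
    Finset.mem_univ, if_true]
  module

/-- Non-emptiness of $M$ enters here: over the empty set the ring $C^\infty(M)$ is zero. -/
theorem wPoly_ne_zero (hM : (M : Set (Fin r → ℝ)).Nonempty) {l : ℤ} (h0 : 0 ≤ l) (hr : l ≤ r) :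
    wPoly r M l ≠ 0 := by
  have : Nonempty M := hM.to_subtype
  have h1 : (1 : Smooth r M) ≠ 0 := fun h =>
    one_ne_zero (α := ℝ) (DFunLike.congr_fun h (Classical.arbitrary M))
  have : Nontrivial (Smooth r M) := ⟨⟨1, 0, h1⟩⟩
  rcases hr.lt_or_eq with hl | rfl
  · intro h
    have h2 := dw_zero_wPoly (M := M) ⟨l.toNat, by omega⟩ l
    rw [h, map_zero, if_pos (by simpa using h0)] at h2
    exact zero_ne_one h2
  · rw [wPoly, dif_neg (by omega), if_pos rfl]
    exact one_ne_zero

/-- Distinct coordinates, and the constant `w^r = 1`, are linearly independent. -/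
theorem eq_zero_of_smul_wPoly_add (hM : (M : Set (Fin r → ℝ)).Nonempty) {l l' : ℤ}
    (hl : 0 ≤ l) (hlr : l ≤ r) (hlt : l' < l) {s t : ℝ}
    (h : s • wPoly r M l + t • wPoly r M l' = 0) : s = 0 := by
  -- The lower index is eliminated first: $l'<l\le r$ makes $w^{l'}$ a true coordinate or zero,
  -- whereas $w^l$ may be the constant $w^r=1$, invisible to derivatives.
  have hz : t • wPoly r M l' = 0 := by
    by_cases h0 : 0 ≤ l'
    · have h2 := congrArg (dw r M ⟨l'.toNat, by omega⟩ 0) h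
      rw [map_add, map_zero, Derivation.map_smul, Derivation.map_smul, dw_zero_wPoly,
        dw_zero_wPoly, if_neg (by simp; omega), if_pos (by simpa using h0), smul_zero,
        zero_add] at h2
      rw [← one_mul (wPoly r M l'), ← smul_mul_assoc, h2, zero_mul]
    · rw [wPoly_eq_zero (by omega), smul_zero]
  rw [hz, add_zero] at h
  exact (smul_eq_zero.1 h).resolve_right (wPoly_ne_zero hM hl hlr)

theorem linearIndependent_opP_of_lt (hM : (M : Set (Fin r → ℝ)).Nonempty)
    (a : Fin (r + 1) → ℝ) {n m : ℕ} (hnm : n < m) (hm : m ≤ r) :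
    LinearIndependent ℝ ![(opP M a n).bivector, (opP M a m).bivector] := by
  rw [LinearIndependent.pair_iff]
  intro s t h
  have key (k : Fin r) : (s * -(2 * fInt n k k)) • wPoly r M (k + k + 1 - n) +
      (t * -(2 * fInt m k k)) • wPoly r M (k + k + 1 - m) = 0 := by
    have h1 : s • ((opP M a n).bivector : Functional r M) +
        t • ((opP M a m).bivector : Functional r M) = 0 := congrArg Subtype.val h
    have h2 := congrArg (fun f => thetaCoeff M k 1 (varTh r M k f)) h1
    simp only [map_add, map_smul, map_zero, thetaCoeff_varTh_opP, smul_smul] at h2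
    exact h2
  -- At $k=n$ one has $f_n^{nn}=-1$ and the indices are $n+1\le r$ and $2n+1-m<n+1$, so the first
  -- coefficient is isolated.
  have hs : s = 0 := by
    have h1 := eq_zero_of_smul_wPoly_add hM (by simp; omega) (by simp; omega) (by simp; omega)
      (key ⟨n, by omega⟩)
    simpa [fInt] using h1
  subst hs
  refine ⟨rfl, ?_⟩
  -- At $k=m-1$ one has $f_m^{kk}=1$ and $2k+1-m=m-1$, so the surviving term is a nonzero multiple
  -- of $t\,w^{m-1}$.
  have h1 := key ⟨m - 1, by omega⟩
  rw [zero_mul, zero_smul, zero_add, smul_eq_zero] at h1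
  have h2 := h1.resolve_right (wPoly_ne_zero hM (by simp; omega) (by simp; omega))
  have h3 : (m : ℤ) - 1 < m := by omega
  have h4 : ((m - 1 : ℕ) : ℤ) < m := by omega
  simpa [fInt, h4] using h2

theorem linearIndependent_opP (hM : (M : Set (Fin r → ℝ)).Nonempty)
    (a : Fin (r + 1) → ℝ) {n m : ℕ} (hn : n ≤ r) (hm : m ≤ r) (hnm : n ≠ m) :
    LinearIndependent ℝ ![(opP M a n).bivector, (opP M a m).bivector] := by
  rcases hnm.lt_or_gt with h | h
  · exact linearIndependent_opP_of_lt hM a h hm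
  · exact LinearIndependent.pair_symm_iff.1 (linearIndependent_opP_of_lt hM a h hn)

end KdVCH


theorem mainTheorem4 (r : ℕ) (M : TopologicalSpace.Opens (Fin r → ℝ))
    (hM : (M : Set (Fin r → ℝ)).Nonempty) (a : Fin (r + 1) → ℝ) :
    (∀ n m : ℕ, n ≤ r → m ≤ r →
      KdVCH.schouten (KdVCH.opP M a n).bivector (KdVCH.opP M a m).bivector = 0) ∧
    (∀ m : ℕ, m ≤ r → (KdVCH.opP M a m).IsHamiltonian) ∧
    (∀ n m : ℕ, n ≤ r → m ≤ r → n ≠ m →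
      KdVCH.Compatible (KdVCH.opP M a n).bivector (KdVCH.opP M a m).bivector) :=
  ⟨fun _ _ hn hm => KdVCH.schouten_opP a hn hm,
    fun m hm => ⟨KdVCH.opP_isSkewAdjoint a m, KdVCH.schouten_opP a hm hm⟩,
    fun _ _ hn hm hnm => ⟨KdVCH.schouten_opP a hn hn, KdVCH.schouten_opP a hm hm,
      KdVCH.linearIndependent_opP hM a hn hm hnm, KdVCH.schouten_opP a hn hm⟩⟩
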